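/- Let $V$ be a real separable Banach space and let $\mathcal{A}:V\to 2^{V}$ be m-accretive (that is, $\|u_1-u_2\|\le\|u_1-u_2+a(\hat u_1-\hat u_2)\|$ for all $a>0$ and $\hat u_i\in\mathcal{A}u_i$, and $R(\mathrm{Id}+a\mathcal{A})=V$ for all $a>0$) with $\{u:\mathcal{A}u\neq\emptyset\}$ dense in $V$. For $u\in V$ let $t\mapsto T(t)u$, $t\ge 0$, be the unique mild solution of $0\in v'(t)+\mathcal{A}v(t)$, $v(0)=u$, i.e. the continuous function which on each interval $[0,b]$ and for each $\varepsilon>0$ is uniformly $\varepsilon$-close to a solution of an $\varepsilon$-discretization (implicit Euler scheme with mesh less than $\varepsilon$ and total error less than $\varepsilon$). Let $V_1,V_2\subseteq V$ be separable Banach spaces with continuous (linear) injections into $V$ which are invariant under every $T(t)$, $t\ge 0$, and assume that there are $\kappa\in(0,\infty)$ and $\rho\in(0,1)$ such that $\|T(t)v\|_{V_1}^{\rho}\le\max(-\kappa t+\|v\|_{V_1}^{\rho},0)$ for all $t\ge0$, $v\in V_1$, and that $\|T(t)v\|_{V_2}\le\|v\|_{V_2}$ for all $t\ge0$, $v\in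 V_2$. On a probability space $(\Omega,\mathcal{F},\mathbb{P})$ let $(\beta_m)_{m\ge1}$ be i.i.d. $(0,\infty)$-valued and $(\eta_m)_{m\ge1}$ be i.i.d. $V$-valued random variables, the two sequences being independent of each other. Assume that, for all $m\ge 1$, $\eta_m\in V_1\cap V_2$ almost surely, $\mathbb{E}\|\eta_m\|_{V_2}^4<\infty$, $\mathbb{E}\|\eta_m\|_{V_1}^{\rho(11+\varepsilon)}<\infty$ and $\mathbb{E}\beta_m^{11+\varepsilon}<\infty$ for some $\varepsilon>0$, and $-\kappa\,\mathbb{E}\beta_m+\mathbb{E}\|\eta_m\|_{V_1}^{\rho}<0$. Let $x$ be a $V$-valued random variable which is independent of $\big((\beta_m)_{m},(\eta_m)_{m}\big)$, with $x\in V_1\cap V_2$ almost surely and $\mathbb{E}\|x\|_{V_1}^{2\rho}<\infty$. Put $\alpha_m:=\sum_{k=1}^m\beta_k$ for $m\ge 0$, $X_0:=x$, $X_m:=T(\beta_m)X_{m-1}+\eta_m$ for $m\ge1$, and $$\mathbb{X}_x(t):=\sum_{m=0}^{\infty}T\big((t-\alpha_m)_+\big)X_m\,\mathbf{1}_{[\alpha_m,\alpha_{m+1})}(t),\qquad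 t\ge0.$$ Let $e_x(0):=0$ and $e_x(n):=\min\{m\ge 1:\ T(\beta_m)X_{m-1}=0,\ m>e_x(n-1)\}\in\mathbb{N}\cup\{\infty\}$ for $n\ge1$. Let $W$ be a real separable Banach space and let $\Xi:V\to W$ be Borel measurable with constants $c_1,c_2\ge0$ such that $\|\Xi(v)\|_W\le c_1\|v\|_{V_2}+c_2$ for all $v\in V_2$. Then, for every $n\ge1$, almost surely $e_x(n)<\infty$, $e_x(n+1)<\infty$ and $\tau\mapsto\Xi(\mathbb{X}_x(\tau))$ is Bochner integrable on $[\alpha_{e_x(n)},\alpha_{e_x(n+1)}]$, and $$\int_{\alpha_{e_x(n)}}^{\alpha_{e_x(n+1)}}\Xi(\mathbb{X}_x(\tau))\,d\tau\in L^2(\Omega;W).$$ -/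

import Mathlib

open MeasureTheory ProbabilityTheory

namespace RandomCauchy

noncomputable section

/-! ### Nonlinear semigroups -/

section Semigroup

variable {U : Type*} [NormedAddCommGroup U] [NormedSpace ℝ U]

/-- A multi-valued operator `A : U → 2^U` is accretive. -/
def Accretive (A : U → Set U) : Prop :=
  ∀ a : ℝ, 0 < a → ∀ u₁ u₂ : U, ∀ v₁ ∈ A u₁, ∀ v₂ ∈ A u₂,
    ‖u₁ - u₂‖ ≤ ‖u₁ - u₂ + a • (v₁ - v₂)‖

/-- `A` is m-accretive: accretive, with `R(Id + a A) = U` for all `a > 0`. -/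
def MAccretive (A : U → Set U) : Prop :=
  Accretive A ∧ ∀ a : ℝ, 0 < a → ∀ y : U, ∃ u : U, ∃ v ∈ A u, u + a • v = y

/-- The domain `D(A) = {u : A u ≠ ∅}` is dense. -/
def DenselyDefined (A : U → Set U) : Prop :=
  Dense {u : U | (A u).Nonempty}

/-- `w` is within `ε` of a solution of an `ε`-discretization of `0 ∈ w' + A w` on `[0, b]`:
a partition `0 = t 0 < t 1 < ⋯ < t N ≤ b` with mesh less than `ε` and `b - ε < t N`, errors
`f (i+1)` of total size `∑ (t (i+1) - t i) ‖f (i+1)‖ < ε`, and values `v 0` at time `0` and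
`v (i+1)` on `(t i, t (i+1)]` with
`f (i+1) ∈ (v (i+1) - v i) / (t (i+1) - t i) + A (v (i+1))`. -/
def HasApproxSolution (A : U → Set U) (w : ℝ → U) (b ε : ℝ) : Prop :=
  ∃ (N : ℕ) (t : ℕ → ℝ) (f v : ℕ → U),
    t 0 = 0 ∧ t N ≤ b ∧ b - ε < t N ∧
    (∀ i < N, t i < t (i + 1) ∧ t (i + 1) - t i < ε) ∧
    (∑ i ∈ Finset.range N, (t (i + 1) - t i) * ‖f (i + 1)‖ < ε) ∧
    (∀ i < N, f (i + 1) - (t (i + 1) - t i)⁻¹ • (v (i + 1) - v i) ∈ A (v (i + 1))) ∧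
    ‖w 0 - v 0‖ < ε ∧
    ∀ i < N, ∀ s ∈ Set.Ioc (t i) (t (i + 1)), ‖w s - v (i + 1)‖ < ε

/-- `w : [0,∞) → U` is a mild solution of `0 ∈ w' + A w`, `w 0 = u`. (Values of `w` at negative
times are irrelevant.) -/
def IsMildSolution (A : U → Set U) (u : U) (w : ℝ → U) : Prop :=
  ContinuousOn w (Set.Ici 0) ∧ w 0 = u ∧
    ∀ b : ℝ, 0 < b → ∀ ε : ℝ, 0 < ε → HasApproxSolution A w b ε

open Classical in
/-- The semigroup `T_A(t) u` associated to `A`, `t ≥ 0`: the value at time `t` of the mild solution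
started in `u`. For `A` m-accretive and densely defined the mild solution exists and is unique on
`[0,∞)`; the value `0` is used when there is none. -/
def semigroup (A : U → Set U) (t : ℝ) (u : U) : U :=
  if h : ∃ w : ℝ → U, IsMildSolution A u w then h.choose t else 0

end Semigroup

/-! ### Continuously embedded subspaces -/

open Classical in
/-- For an injection `ι : V' → V`, the `V'`-norm of `u ∈ V`, extended by `0` outside of `V'`. -/
def embNorm {V' V : Type*} [NormedAddCommGroup V'] (ι : V' → V) (u : V) : ℝ :=
  if u ∈ Set.range ι then ‖Function.invFun ι u‖ else 0

/-! ### The generated sequence and process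

Sequences that are indexed by `1, 2, 3, …` in the mathematics are indexed from `0` here for the data:
`β k` and `η k` stand for `β_{k+1}` and `η_{k+1}`. The indices of `arrival`, `genSeq` and
`extinctionIndex` are not shifted. -/

section Generated

variable {Ω V : Type*} [NormedAddCommGroup V] [NormedSpace ℝ V]

/-- `α_m = β_1 + ⋯ + β_m`. -/
def arrival (β : ℕ → Ω → ℝ) (m : ℕ) (ω : Ω) : ℝ :=
  ∑ k ∈ Finset.range m, β k ω

/-- The sequence with `X_{x,0} = x` and `X_{x,m} = T_A(β_m) X_{x,m-1} + η_m`. -/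
def genSeq (A : V → Set V) (β : ℕ → Ω → ℝ) (η : ℕ → Ω → V) (x : Ω → V) : ℕ → Ω → V
  | 0 => x
  | m + 1 => fun ω => semigroup A (β m ω) (genSeq A β η x m ω) + η m ω

/-- The process `X_x(t) = ∑_m T_A((t - α_m)₊) X_{x,m} 1_{[α_m, α_{m+1})}(t)`. -/
def genProcess (A : V → Set V) (β : ℕ → Ω → ℝ) (η : ℕ → Ω → V) (x : Ω → V) (t : ℝ) (ω : Ω) : V :=
  ∑' m : ℕ, (Set.Ico (arrival β m ω) (arrival β (m + 1) ω)).indicator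
    (fun s => semigroup A (max (s - arrival β m ω) 0) (genSeq A β η x m ω)) t

/-- The extinction indices: `e_x(0) = 0` and
`e_x(n+1) = min {m ≥ 1 : T_A(β_m) X_{x,m-1} = 0, m > e_x(n)}`, with `min ∅ = ∞`. -/
def extinctionIndex (A : V → Set V) (β : ℕ → Ω → ℝ) (η : ℕ → Ω → V) (x : Ω → V) : ℕ → Ω → ℕ∞
  | 0 => fun _ => 0
  | n + 1 => fun ω => sInf {m : ℕ∞ | ∃ k : ℕ, m = ((k + 1 : ℕ) : ℕ∞) ∧
      semigroup A (β k ω) (genSeq A β η x k ω) = 0 ∧ extinctionIndex A β η x n ω < m}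

/-- The time `α_{e_x(n)}`. (Where `e_x(n) = ∞`, which has probability zero under the assumptions
below, the value is `0`.) -/
def extinctionTime (A : V → Set V) (β : ℕ → Ω → ℝ) (η : ℕ → Ω → V) (x : Ω → V) (n : ℕ) (ω : Ω) :
    ℝ :=
  arrival β (extinctionIndex A β η x n ω).toNat ω

end Generated

/-! ### The assumptions -/

section Assumptions

variable {V V₁ V₂ : Type*}
  [NormedAddCommGroup V] [NormedSpace ℝ V]
  [NormedAddCommGroup V₁] [NormedSpace ℝ V₁]
  [NormedAddCommGroup V₂] [NormedSpace ℝ V₂]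

/-- The functional analytic assumption on `T_A` and the subspaces `V₁`, `V₂` of `V`. -/
structure SemigroupAssumption (A : V → Set V) (ι₁ : V₁ →L[ℝ] V) (ι₂ : V₂ →L[ℝ] V)
    (κ ρ : ℝ) : Prop where
  invariant₁ : ∀ t : ℝ, 0 ≤ t → ∀ v : V₁, semigroup A t (ι₁ v) ∈ Set.range ι₁
  invariant₂ : ∀ t : ℝ, 0 ≤ t → ∀ v : V₂, semigroup A t (ι₂ v) ∈ Set.range ι₂
  kappa_pos : 0 < κ
  rho_pos : 0 < ρ
  rho_lt_one : ρ < 1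
  extinction : ∀ t : ℝ, 0 ≤ t → ∀ v : V₁,
    embNorm ι₁ (semigroup A t (ι₁ v)) ^ ρ ≤ max (-κ * t + ‖v‖ ^ ρ) 0
  contraction : ∀ t : ℝ, 0 ≤ t → ∀ v : V₂, embNorm ι₂ (semigroup A t (ι₂ v)) ≤ ‖v‖

variable {Ω : Type*} [MeasurableSpace Ω] [MeasurableSpace V]

/-- The assumptions on the noise `(β_m)`, `(η_m)`. -/
structure NoiseAssumption (P : Measure Ω) (ι₁ : V₁ →L[ℝ] V) (ι₂ : V₂ →L[ℝ] V) (κ ρ ε : ℝ)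
    (β : ℕ → Ω → ℝ) (η : ℕ → Ω → V) : Prop where
  measurable_beta : ∀ m, Measurable (β m)
  measurable_eta : ∀ m, Measurable (η m)
  beta_pos : ∀ m ω, 0 < β m ω
  indep_beta : iIndepFun β P
  indep_eta : iIndepFun η P
  ident_beta : ∀ m n, IdentDistrib (β m) (β n) P P
  ident_eta : ∀ m n, IdentDistrib (η m) (η n) P P
  indep_eta_beta : IndepFun (fun ω m => η m ω) (fun ω m => β m ω) P
  eta_mem₁ : ∀ m, ∀ᵐ ω ∂P, η m ω ∈ Set.range ι₁
  eta_mem₂ : ∀ m, ∀ᵐ ω ∂P, η m ω ∈ Set.range ι₂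
  moment_eta₂ : ∀ m, Integrable (fun ω => embNorm ι₂ (η m ω) ^ 4) P
  eps_pos : 0 < ε
  moment_eta₁ : ∀ m, Integrable (fun ω => embNorm ι₁ (η m ω) ^ (ρ * (11 + ε))) P
  moment_beta : ∀ m, Integrable (fun ω => β m ω ^ (11 + ε)) P
  drift : ∀ m, -κ * (∫ ω, β m ω ∂P) + ∫ ω, embNorm ι₁ (η m ω) ^ ρ ∂P < 0

/-- `x` is an independent initial value leading to extinction. -/
structure IndependentInitial (P : Measure Ω) (ι₁ : V₁ →L[ℝ] V) (ι₂ : V₂ →L[ℝ] V) (ρ : ℝ)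
    (β : ℕ → Ω → ℝ) (η : ℕ → Ω → V) (x : Ω → V) : Prop where
  measurable : Measurable x
  mem₁ : ∀ᵐ ω ∂P, x ω ∈ Set.range ι₁
  mem₂ : ∀ᵐ ω ∂P, x ω ∈ Set.range ι₂
  moment : Integrable (fun ω => embNorm ι₁ (x ω) ^ (2 * ρ)) P
  indep : IndepFun x (fun ω => ((fun m => β m ω), (fun m => η m ω))) P

/-- `(Ξ, W) ∈ SL_{V₂}(V)`: `Ξ` is Borel measurable and sub-linear with respect to the norm of
`V₂`. -/
structure SubLinear {W : Type*} [NormedAddCommGroup W] [MeasurableSpace W]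
    (ι₂ : V₂ →L[ℝ] V) (Ξ : V → W) : Prop where
  measurable : Measurable Ξ
  bound : ∃ c₁ c₂ : ℝ, 0 ≤ c₁ ∧ 0 ≤ c₂ ∧ ∀ v : V₂, ‖Ξ (ι₂ v)‖ ≤ c₁ * ‖v‖ + c₂

end Assumptions

end

end RandomCauchy

/-! Let j be an index with T(β_j)X_j = 0 (noise indexed from 0, as in the code). Then X_{j+1} = η_j:
the past is forgotten and the process restarts from a single jump. Two pathwise facts describe the
excursion that follows. Contraction in V₂ gives ‖X_{j+1+l}‖ ≤ ∑_{k ≤ l} ‖η_{j+k}‖, so the norm of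
the integral is at most ∑_l β_{j+1+l} ∑_{k ≤ l} h_{j+k}, with h_i = c₁‖η_i‖ + c₂
(`integral_between_extinctions`). In V₁, since s ↦ s^ρ is subadditive, ‖X‖^ρ stays below a walk with
increments ‖η‖^ρ - κβ until the next extinction; hence the l-th summand occurs only on the event
E_{j,l} that this walk is still nonnegative (`walk_nonneg`). The drift is negative, so by the strong
law the walk tends to -∞ and every extinction index is finite.

For the second moment, weighted Cauchy–Schwarz reduces the claim to the expectations of β_{j+1+l}²
h_{j+k}² 1_{E_{j,l}}. The factor β_{j+1+l} is independent of the rest, and `exists_tail_moment`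
bounds E[h_{j+k}² 1_{E_{j,l}}] by C(l+1)^{-5}. Indeed E_{j,l} forces a deviation of order l in one
of three centred quantities: the η-walk without its k-th term, the β-walk, or the single k-th term.
The first two are independent of h_{j+k}, and their tenth moments are O(l⁵), so Markov's inequality
gives l⁵/l¹⁰. The third is correlated with h_{j+k} and is paid for by its own tenth moment and the
fourth moment of h.

Finally Ω is split into the events that the starting extinction has index j + 1. Such an event
depends only on x, η_i for i < j and β_i for i ≤ j, hence is independent of the bound on the
excursion. The constant is uniform in j and the probabilities sum to at most 1.

All of this needs T(t)u to be jointly measurable, which follows from Kobayashi's estimate: mild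
solutions are unique and depend contractively on their initial values. -/

namespace RandomCauchy

noncomputable section

/-! ### Mild solutions: contraction, uniqueness, measurability of the semigroup. -/

section Semigroup

variable {U : Type*} [NormedAddCommGroup U] [NormedSpace ℝ U] {A : U → Set U}

lemma Accretive.implicit_step_sub_le (hA : Accretive A) {δ : ℝ} (hδ : 0 < δ) {f v v' z z' : U}
    (hv : f - δ⁻¹ • (v - v') ∈ A v) (hz : z' ∈ A z) :
    ‖v - z‖ ≤ ‖v' - z‖ + δ * ‖f‖ + δ * ‖z'‖ := by
  have h := hA δ hδ v z _ hv _ hz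
  have e : v - z + δ • (f - δ⁻¹ • (v - v') - z') = (v' - z) + (δ • f - δ • z') := by
    rw [smul_sub, smul_sub, smul_smul, mul_inv_cancel₀ hδ.ne', one_smul]; abel
  rw [e] at h
  have h1 := norm_add_le (v' - z) (δ • f - δ • z')
  have h2 := norm_sub_le (δ • f) (δ • z')
  rw [norm_smul, norm_smul, Real.norm_of_nonneg hδ.le] at h2
  linarith

/-- The accretivity parameter δh/(δ+h) is the one for which the terms in v - u cancel after
multiplication by δ + h, leaving a combination of the two differences with one step undone. -/
lemma Accretive.two_implicit_steps (hA : Accretive A) {δ h : ℝ} (hδ : 0 < δ) (hh : 0 < h)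
    {f v v' g u u' : U} (hv : f - δ⁻¹ • (v - v') ∈ A v) (hu : g - h⁻¹ • (u - u') ∈ A u) :
    (δ + h) * ‖v - u‖ ≤ δ * ‖v - u'‖ + h * ‖v' - u‖ + δ * h * (‖f‖ + ‖g‖) := by
  have hs : 0 < δ + h := by positivity
  have hac := hA (δ * h / (δ + h)) (by positivity) v u _ hv _ hu
  have e : (δ + h) • (v - u + (δ * h / (δ + h)) • (f - δ⁻¹ • (v - v') - (g - h⁻¹ • (u - u'))))
      = (δ • (v - u') + h • (v' - u)) + (δ * h) • (f - g) := by
    match_scalars <;> field_simp <;> ring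
  have h1 : (δ + h) * ‖v - u‖ ≤ ‖(δ • (v - u') + h • (v' - u)) + (δ * h) • (f - g)‖ := by
    rw [← e, norm_smul, Real.norm_of_nonneg hs.le]
    exact mul_le_mul_of_nonneg_left hac hs.le
  refine h1.trans ((norm_add_le _ _).trans ?_)
  have h2 := norm_add_le (δ • (v - u')) (h • (v' - u))
  rw [norm_smul, norm_smul, Real.norm_of_nonneg hδ.le, Real.norm_of_nonneg hh.le] at h2
  have h3 : ‖(δ * h) • (f - g)‖ ≤ δ * h * (‖f‖ + ‖g‖) := by
    rw [norm_smul, Real.norm_of_nonneg (by positivity)]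
    exact mul_le_mul_of_nonneg_left (norm_sub_le _ _) (by positivity)
  linarith

/-- This says that √((t-s)² + Δ(t+s)) is a supersolution of the two-step recursion. Averaging the
squares adds δh(δ+h) and removes 2Δδh, a net decrease because δ, h ≤ Δ; concavity of the root does
the rest. -/
lemma weighted_sqrt_le {δ h Δ D S : ℝ} (hδ : 0 < δ) (hh : 0 < h) (hδΔ : δ ≤ Δ) (hhΔ : h ≤ Δ)
    (hSh : h ≤ S) (hSδ : δ ≤ S) :
    δ * √((D + h) ^ 2 + Δ * (S - h)) + h * √((D - δ) ^ 2 + Δ * (S - δ)) ≤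
      (δ + h) * √(D ^ 2 + Δ * S) := by
  have hs : 0 < δ + h := by positivity
  have hΔ : 0 ≤ Δ := hδ.le.trans hδΔ
  have h1 : 0 ≤ (D + h) ^ 2 + Δ * (S - h) :=
    add_nonneg (sq_nonneg _) (mul_nonneg hΔ (sub_nonneg.2 hSh))
  have h2 : 0 ≤ (D - δ) ^ 2 + Δ * (S - δ) :=
    add_nonneg (sq_nonneg _) (mul_nonneg hΔ (sub_nonneg.2 hSδ))
  have hm : δ * ((D + h) ^ 2 + Δ * (S - h)) + h * ((D - δ) ^ 2 + Δ * (S - δ)) ≤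
      (δ + h) * (D ^ 2 + Δ * S) := by
    nlinarith [mul_pos hδ hh]
  set a := √((D + h) ^ 2 + Δ * (S - h)) with ha
  set b := √((D - δ) ^ 2 + Δ * (S - δ)) with hb
  have ha2 : a ^ 2 = (D + h) ^ 2 + Δ * (S - h) := Real.sq_sqrt h1
  have hb2 : b ^ 2 = (D - δ) ^ 2 + Δ * (S - δ) := Real.sq_sqrt h2
  have key : (δ * a + h * b) / (δ + h) ≤ √(D ^ 2 + Δ * S) := by
    apply Real.le_sqrt_of_sq_le
    rw [div_pow, div_le_iff₀ (by positivity)]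
    rw [← ha2, ← hb2] at hm
    nlinarith [mul_pos hδ hh, mul_nonneg (mul_pos hδ hh).le (sq_nonneg (a - b)),
      mul_le_mul_of_nonneg_left hm hs.le]
  rw [div_le_iff₀ hs] at key
  linarith

lemma partition_nonneg {t : ℕ → ℝ} {N : ℕ} (t0 : t 0 = 0) (ht : ∀ i < N, t i < t (i + 1)) :
    ∀ i ≤ N, 0 ≤ t i := by
  intro i
  induction i with
  | zero => intro _; exact t0.ge
  | succ i ih => intro hi; exact (ih (by omega)).trans (ht i (by omega)).le

lemma Accretive.discretization_sub_le (hA : Accretive A) {t : ℕ → ℝ} {f v : ℕ → U} {N : ℕ}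
    (t0 : t 0 = 0) (ht : ∀ i < N, t i < t (i + 1))
    (hv : ∀ i < N, f (i + 1) - (t (i + 1) - t i)⁻¹ • (v (i + 1) - v i) ∈ A (v (i + 1)))
    {z z' : U} (hz : z' ∈ A z) :
    ∀ i ≤ N, ‖v i - z‖ ≤ ‖v 0 - z‖ + ‖z'‖ * t i +
      ∑ k ∈ Finset.range i, (t (k + 1) - t k) * ‖f (k + 1)‖ := by
  intro i
  induction i with
  | zero => intro _; simp [t0]
  | succ i ih =>
    intro hi
    have h1 := ih (by omega)
    have h2 := hA.implicit_step_sub_le (sub_pos.2 (ht i (by omega))) (hv i (by omega)) hz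
    rw [Finset.sum_range_succ]
    linarith

/-- Kobayashi's estimate for two implicit Euler schemes. -/
lemma Accretive.kobayashi (hA : Accretive A) {t s : ℕ → ℝ} {f v g u : ℕ → U} {N M : ℕ} {Δ : ℝ}
    (hΔ : 0 ≤ Δ) (t0 : t 0 = 0) (s0 : s 0 = 0)
    (ht : ∀ i < N, t i < t (i + 1)) (htΔ : ∀ i < N, t (i + 1) - t i ≤ Δ)
    (hs : ∀ j < M, s j < s (j + 1)) (hsΔ : ∀ j < M, s (j + 1) - s j ≤ Δ)
    (hv : ∀ i < N, f (i + 1) - (t (i + 1) - t i)⁻¹ • (v (i + 1) - v i) ∈ A (v (i + 1)))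
    (hu : ∀ j < M, g (j + 1) - (s (j + 1) - s j)⁻¹ • (u (j + 1) - u j) ∈ A (u (j + 1)))
    {z z' : U} (hz : z' ∈ A z) :
    ∀ i ≤ N, ∀ j ≤ M, ‖v i - u j‖ ≤ ‖v 0 - z‖ + ‖u 0 - z‖ +
      ‖z'‖ * √((t i - s j) ^ 2 + Δ * (t i + s j)) +
      ∑ k ∈ Finset.range i, (t (k + 1) - t k) * ‖f (k + 1)‖ +
      ∑ k ∈ Finset.range j, (s (k + 1) - s k) * ‖g (k + 1)‖ := by
  have htn := partition_nonneg t0 ht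
  have hsn := partition_nonneg s0 hs
  intro i
  induction i with
  | zero =>
    intro _ j hj
    have h1 := hA.discretization_sub_le s0 hs hu hz j hj
    have h2 : ‖v 0 - u j‖ ≤ ‖v 0 - z‖ + ‖u j - z‖ := by
      rw [norm_sub_rev (u j) z]; exact norm_sub_le_norm_sub_add_norm_sub _ _ _
    -- On the boundary of the grid the root dominates the elapsed time, so the one-scheme estimate
    -- suffices.
    have h3 : s j ≤ √((t 0 - s j) ^ 2 + Δ * (t 0 + s j)) := by
      apply Real.le_sqrt_of_sq_le
      rw [t0]
      nlinarith [mul_nonneg hΔ (hsn j hj)]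
    have h4 := mul_le_mul_of_nonneg_left h3 (norm_nonneg z')
    simp only [Finset.range_zero, Finset.sum_empty, add_zero]
    linarith
  | succ i ih =>
    intro hi j
    induction j with
    | zero =>
      intro _
      have h1 := hA.discretization_sub_le t0 ht hv hz (i + 1) hi
      have h2 : ‖v (i + 1) - u 0‖ ≤ ‖v (i + 1) - z‖ + ‖u 0 - z‖ := by
        rw [norm_sub_rev (u 0) z]; exact norm_sub_le_norm_sub_add_norm_sub _ _ _
      have h3 : t (i + 1) ≤ √((t (i + 1) - s 0) ^ 2 + Δ * (t (i + 1) + s 0)) := by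
        apply Real.le_sqrt_of_sq_le
        rw [s0]
        nlinarith [mul_nonneg hΔ (htn (i + 1) hi)]
      have h4 := mul_le_mul_of_nonneg_left h3 (norm_nonneg z')
      simp only [Finset.range_zero, Finset.sum_empty, add_zero]
      linarith
    | succ j jh =>
      intro hj
      have b1 := jh (by omega)
      have b2 := ih (by omega) (j + 1) hj
      have hδ := sub_pos.2 (ht i (by omega))
      have hh := sub_pos.2 (hs j (by omega))
      have key := hA.two_implicit_steps hδ hh (hv i (by omega)) (hu j (by omega))
      have htn0 := htn i (by omega)
      have htn1 := htn (i + 1) hi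
      have hsn0 := hsn j (by omega)
      have hsn1 := hsn (j + 1) hj
      have w := weighted_sqrt_le (D := t (i + 1) - s (j + 1)) (S := t (i + 1) + s (j + 1)) hδ hh
        (htΔ i (by omega)) (hsΔ j (by omega)) (by linarith) (by linarith)
      have e1 : t (i + 1) - s (j + 1) + (s (j + 1) - s j) = t (i + 1) - s j := by ring
      have e2 : t (i + 1) + s (j + 1) - (s (j + 1) - s j) = t (i + 1) + s j := by ring
      have e3 : t (i + 1) - s (j + 1) - (t (i + 1) - t i) = t i - s (j + 1) := by ring
      have e4 : t (i + 1) + s (j + 1) - (t (i + 1) - t i) = t i + s (j + 1) := by ring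
      rw [e1, e2, e3, e4] at w
      have w' := mul_le_mul_of_nonneg_left w (norm_nonneg z')
      rw [Finset.sum_range_succ] at b1 b2 ⊢
      rw [Finset.sum_range_succ _ j]
      set δ := t (i + 1) - t i
      set h := s (j + 1) - s j
      -- The error sums match exactly: the term δh(‖f‖ + ‖g‖) of `key` supplies the last summand
      -- missing from each of the two induction hypotheses.
      have c1 := mul_le_mul_of_nonneg_left b1 hδ.le
      have c2 := mul_le_mul_of_nonneg_left b2 hh.le
      refine le_of_mul_le_mul_left ?_ (add_pos hδ hh)
      refine key.trans ((add_le_add_left (add_le_add c1 c2) _).trans ?_)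
      linarith

lemma IsMildSolution.exists_approx {u : U} {w : ℝ → U} (hw : IsMildSolution A u w) {τ ε : ℝ}
    (hτ : 0 < τ) (hε : 0 < ε) :
    ∃ (N : ℕ) (t : ℕ → ℝ) (f v : ℕ → U),
      t 0 = 0 ∧ t N ≤ τ ∧ τ - ε < t N ∧ (∀ i < N, t i < t (i + 1)) ∧
      (∀ i < N, t (i + 1) - t i ≤ ε) ∧
      (∑ i ∈ Finset.range N, (t (i + 1) - t i) * ‖f (i + 1)‖ < ε) ∧
      (∀ i < N, f (i + 1) - (t (i + 1) - t i)⁻¹ • (v (i + 1) - v i) ∈ A (v (i + 1))) ∧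
      ‖u - v 0‖ < ε ∧ ‖w τ - v N‖ < ε := by
  obtain ⟨hc, h0, h⟩ := hw
  have hcτ := Metric.continuousWithinAt_iff.1 (hc τ hτ.le) (ε / 2) (by positivity)
  obtain ⟨d, hd, hcτ⟩ := hcτ
  -- The bound e ≤ d keeps the last node within the continuity window at τ, and e ≤ τ forces t N >
  -- 0, so that there is at least one step.
  set e := min (min (ε / 2) d) τ with he
  have he0 : 0 < e := by positivity
  have hed : e ≤ d := (min_le_left _ _).trans (min_le_right _ _)
  have heε : e ≤ ε / 2 := (min_le_left _ _).trans (min_le_left _ _)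
  have heτ : e ≤ τ := min_le_right _ _
  obtain ⟨N, t, f, v, t0, tN, tN', ht, hf, hv, hv0, hwv⟩ := h τ hτ e he0
  refine ⟨N, t, f, v, t0, tN, by linarith, fun i hi => (ht i hi).1,
    fun i hi => (ht i hi).2.le.trans (by linarith), by linarith, hv, ?_, ?_⟩
  · rw [← h0]; linarith
  · have hN : N ≠ 0 := by
      rintro rfl
      rw [t0] at tN'; linarith
    obtain ⟨m, rfl⟩ := Nat.exists_eq_succ_of_ne_zero hN
    have h1 := hwv m (by omega) (t (m + 1)) ⟨(ht m (by omega)).1, le_rfl⟩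
    have h2 := hcτ (x := t (m + 1)) (show (0 : ℝ) ≤ _ by
      simp only [Nat.succ_eq_add_one] at *; linarith) (by
      simp only [Nat.succ_eq_add_one] at *
      rw [Real.dist_eq, abs_lt]; constructor <;> linarith)
    rw [dist_comm, dist_eq_norm] at h2
    have h3 := norm_sub_le_norm_sub_add_norm_sub (w τ) (w (t (m + 1))) (v (m + 1))
    simp only [Nat.succ_eq_add_one] at *
    linarith

/-- Mild solutions depend contractively on their initial values. -/
lemma IsMildSolution.norm_sub_le (hA : Accretive A) (hD : DenselyDefined A) {u₁ u₂ : U}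
    {w₁ w₂ : ℝ → U} (h₁ : IsMildSolution A u₁ w₁) (h₂ : IsMildSolution A u₂ w₂) {τ : ℝ}
    (hτ : 0 ≤ τ) : ‖w₁ τ - w₂ τ‖ ≤ ‖u₁ - u₂‖ := by
  rcases hτ.eq_or_lt with rfl | hτ
  · rw [h₁.2.1, h₂.2.1]
  -- Kobayashi's estimate needs a reference point z in the domain of A. The mesh goes to 0 first,
  -- which removes ‖z'‖; then z goes to u₁ by density.
  have main : ∀ z z', z' ∈ A z → ‖w₁ τ - w₂ τ‖ ≤ ‖u₁ - z‖ + ‖u₂ - z‖ := by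
    intro z z' hz
    have step : ∀ ε : ℝ, 0 < ε → ‖w₁ τ - w₂ τ‖ ≤
        ‖u₁ - z‖ + ‖u₂ - z‖ + ‖z'‖ * √(ε ^ 2 + ε * (τ + τ)) + 6 * ε := by
      intro ε hε
      obtain ⟨N, t, f, v, t0, tN, tN', ht, htε, hf, hv, hv0, hvN⟩ := h₁.exists_approx hτ hε
      obtain ⟨M, s, g, u, s0, sM, sM', hs, hsε, hg, hu, hu0, huM⟩ := h₂.exists_approx hτ hε
      have k := hA.kobayashi hε.le t0 s0 ht htε hs hsε hv hu hz N le_rfl M le_rfl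
      have k1 : √((t N - s M) ^ 2 + ε * (t N + s M)) ≤ √(ε ^ 2 + ε * (τ + τ)) := by
        apply Real.sqrt_le_sqrt
        apply add_le_add
        · apply sq_le_sq'  <;> linarith
        · exact mul_le_mul_of_nonneg_left (by linarith) hε.le
      have k2 := mul_le_mul_of_nonneg_left k1 (norm_nonneg z')
      have k3 := norm_sub_le_norm_sub_add_norm_sub (w₁ τ) (v N) (w₂ τ)
      have k4 := norm_sub_le_norm_sub_add_norm_sub (v N) (u M) (w₂ τ)
      have k5 := norm_sub_le_norm_sub_add_norm_sub (v 0) u₁ z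
      have k6 := norm_sub_le_norm_sub_add_norm_sub (u 0) u₂ z
      rw [norm_sub_rev] at hv0 hu0 huM
      linarith
    have hlim : Filter.Tendsto (fun ε : ℝ => ‖u₁ - z‖ + ‖u₂ - z‖ +
        ‖z'‖ * √(ε ^ 2 + ε * (τ + τ)) + 6 * ε) (nhdsWithin 0 (Set.Ioi 0))
        (nhds (‖u₁ - z‖ + ‖u₂ - z‖)) := by
      have hcont : Continuous (fun ε : ℝ => ‖u₁ - z‖ + ‖u₂ - z‖ +
        ‖z'‖ * √(ε ^ 2 + ε * (τ + τ)) + 6 * ε) := by fun_prop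
      have := (hcont.tendsto 0).mono_left (nhdsWithin_le_nhds (s := Set.Ioi 0))
      simpa using this
    exact ge_of_tendsto hlim (Filter.eventually_of_mem self_mem_nhdsWithin step)
  have hcl : IsClosed {z : U | ‖w₁ τ - w₂ τ‖ ≤ ‖u₁ - z‖ + ‖u₂ - z‖} :=
    isClosed_le continuous_const (by fun_prop)
  have hsub : {z : U | (A z).Nonempty} ⊆ {z : U | ‖w₁ τ - w₂ τ‖ ≤ ‖u₁ - z‖ + ‖u₂ - z‖} :=
    fun z ⟨z', hz⟩ => main z z' hz
  have : u₁ ∈ {z : U | ‖w₁ τ - w₂ τ‖ ≤ ‖u₁ - z‖ + ‖u₂ - z‖} :=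
    hcl.closure_subset_iff.2 hsub (hD u₁)
  simpa [norm_sub_rev] using this

lemma IsMildSolution.semigroup_eq (hA : Accretive A) (hD : DenselyDefined A) {u : U} {w : ℝ → U}
    (h : IsMildSolution A u w) {τ : ℝ} (hτ : 0 ≤ τ) : semigroup A τ u = w τ := by
  have hex : ∃ w : ℝ → U, IsMildSolution A u w := ⟨w, h⟩
  rw [semigroup, dif_pos hex, ← sub_eq_zero, ← norm_le_zero_iff]
  simpa using hex.choose_spec.norm_sub_le hA hD h hτ

/-- By contraction, convergence of initial values makes the solutions converge uniformly on [0,∞); a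
discretization that is ε/2-close to a nearby solution then also serves the limit. -/
lemma isClosed_setOf_exists_isMildSolution [CompleteSpace U] (hA : Accretive A)
    (hD : DenselyDefined A) : IsClosed {u : U | ∃ w, IsMildSolution A u w} := by
  refine isClosed_of_closure_subset fun u hu => ?_
  obtain ⟨a, ha, hau⟩ := mem_closure_iff_seq_limit.1 hu
  choose w hw using ha
  have hcau : ∀ s : ℝ, 0 ≤ s → CauchySeq fun n => w n s := by
    intro s hs
    rw [Metric.cauchySeq_iff]
    intro ε hε
    obtain ⟨N, hN⟩ := Metric.cauchySeq_iff.1 hau.cauchySeq ε hε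
    refine ⟨N, fun m hm n hn => ?_⟩
    refine lt_of_le_of_lt ?_ (hN m hm n hn)
    rw [dist_eq_norm, dist_eq_norm]
    exact (hw m).norm_sub_le hA hD (hw n) hs
  have hlim : ∀ s : ℝ, ∃ l, 0 ≤ s → Filter.Tendsto (fun n => w n s) Filter.atTop (nhds l) := by
    intro s
    by_cases hs : 0 ≤ s
    · obtain ⟨l, hl⟩ := cauchySeq_tendsto_of_complete (hcau s hs)
      exact ⟨l, fun _ => hl⟩
    · exact ⟨0, fun h => absurd h hs⟩
  choose W hW using hlim
  have hbound : ∀ n s, 0 ≤ s → ‖w n s - W s‖ ≤ ‖a n - u‖ := by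
    intro n s hs
    have l1 := ((hW s hs).const_sub (w n s)).norm
    have l2 := (hau.const_sub (a n)).norm
    exact le_of_tendsto_of_tendsto' l1 l2 fun m => (hw n).norm_sub_le hA hD (hw m) hs
  have hsmall : ∀ ε > 0, ∃ n, ‖a n - u‖ < ε := by
    intro ε hε
    obtain ⟨n, hn⟩ := Metric.tendsto_atTop.1 hau ε hε
    exact ⟨n, by simpa [dist_eq_norm] using hn n le_rfl⟩
  refine ⟨W, ?_, ?_, ?_⟩
  · refine TendstoUniformlyOn.continuousOn (F := w) (p := Filter.atTop) ?_
      (Filter.Frequently.of_forall fun n => (hw n).1)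
    rw [Metric.tendstoUniformlyOn_iff]
    intro ε hε
    filter_upwards [Metric.tendsto_nhds.1 hau ε hε] with n hn s hs
    rw [dist_comm, dist_eq_norm]
    exact (hbound n s hs).trans_lt (by simpa [dist_eq_norm] using hn)
  · refine tendsto_nhds_unique (hW 0 le_rfl) ?_
    simpa only [fun n => (hw n).2.1] using hau
  · intro b hb ε hε
    obtain ⟨n, hn⟩ := hsmall (ε / 2) (by positivity)
    obtain ⟨N, t, f, v, t0, tN, tN', ht, hf, hv, hv0, hwv⟩ := (hw n).2.2 b hb (ε / 2) (by positivity)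
    have htn := partition_nonneg t0 fun i hi => (ht i hi).1
    have tri : ∀ s v, 0 ≤ s → ‖w n s - v‖ < ε / 2 → ‖W s - v‖ < ε := by
      intro s v hs h
      have h1 := hbound n s hs
      have h2 := norm_sub_le_norm_sub_add_norm_sub (W s) (w n s) v
      rw [norm_sub_rev] at h1
      linarith
    refine ⟨N, t, f, v, t0, tN, by linarith, fun i hi => ⟨(ht i hi).1, by linarith [(ht i hi).2]⟩,
      by linarith, hv, tri _ _ le_rfl hv0, fun i hi s hs => tri _ _ ?_ (hwv i hi s hs)⟩
    exact (htn i hi.le).trans hs.1.le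

/-- On the closed set where a mild solution exists the semigroup is jointly continuous, being
continuous in time and contractive in u; elsewhere it is the default value 0. The truncation `max
p.1 0` avoids negative times, where mild solutions are unconstrained. -/
lemma measurable_semigroup [CompleteSpace U] [SecondCountableTopology U] [MeasurableSpace U]
    [BorelSpace U] (hA : Accretive A) (hD : DenselyDefined A) :
    Measurable fun p : ℝ × U => semigroup A (max p.1 0) p.2 := by
  classical
  set E : Set (ℝ × U) := {p | ∃ w, IsMildSolution A p.2 w} with hE
  have hEc : IsClosed E := (isClosed_setOf_exists_isMildSolution hA hD).preimage continuous_snd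
  have hcont : ContinuousOn (fun p : ℝ × U => semigroup A (max p.1 0) p.2) E := by
    rintro ⟨t, u⟩ ⟨w, hw⟩
    rw [ContinuousWithinAt, tendsto_iff_norm_sub_tendsto_zero]
    have hwc : Continuous fun s : ℝ => w (max s 0) :=
      hw.1.comp_continuous (by fun_prop) fun s => le_max_right s 0
    have hlim : Filter.Tendsto (fun p : ℝ × U => ‖p.2 - u‖ + ‖w (max p.1 0) - w (max t 0)‖)
        (nhdsWithin (t, u) E) (nhds 0) := by
      have hc : Continuous (fun p : ℝ × U => ‖p.2 - u‖ + ‖w (max p.1 0) - w (max t 0)‖) := by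
        exact (continuous_snd.sub continuous_const).norm.add
          (((hwc.comp continuous_fst).sub continuous_const).norm)
      simpa using (hc.tendsto (t, u)).mono_left (nhdsWithin_le_nhds (s := E))
    refine squeeze_zero' (Filter.Eventually.of_forall fun _ => norm_nonneg _) ?_ hlim
    filter_upwards [self_mem_nhdsWithin] with p hp
    obtain ⟨w', hw'⟩ := hp
    rw [hw'.semigroup_eq hA hD (le_max_right _ _), hw.semigroup_eq hA hD (le_max_right _ _)]
    have h1 := hw'.norm_sub_le hA hD hw (le_max_right p.1 0)
    have h2 := norm_sub_le_norm_sub_add_norm_sub (w' (max p.1 0)) (w (max p.1 0)) (w (max t 0))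
    linarith
  have hpw : (fun p : ℝ × U => semigroup A (max p.1 0) p.2) =
      E.piecewise (fun p => semigroup A (max p.1 0) p.2) (fun _ => 0) := by
    ext p
    by_cases hp : p ∈ E
    · rw [Set.piecewise_eq_of_mem _ _ _ hp]
    · rw [Set.piecewise_eq_of_notMem _ _ _ hp]
      exact dif_neg hp
  rw [hpw]
  exact hcont.measurable_piecewise continuousOn_const hEc.measurableSet

end Semigroup

/-! ### Moments of sums of independent centred variables. -/

section Moments

lemma abs_pow_le_one_add_abs_pow (s : ℝ) {m n : ℕ} (h : m ≤ n) : |s| ^ m ≤ 1 + |s| ^ n := by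
  rcases le_total |s| 1 with h1 | h1
  · have := pow_le_one₀ (n := m) (abs_nonneg s) h1
    have := pow_nonneg (abs_nonneg s) n
    linarith
  · have := pow_le_pow_right₀ h1 h
    linarith

/-- The summand linear in y is kept apart because it has mean zero when y is centred and independent
of s. All further terms have degree at most 2q in s, so a moment two orders lower controls them. -/
lemma add_pow_even_le (s y : ℝ) (q : ℕ) :
    (s + y) ^ (2 * q + 2) ≤ s ^ (2 * q + 2) + (2 * q + 2) * (s ^ (2 * q + 1) * y) +
      2 ^ (2 * q + 2) * ((1 + s ^ (2 * q)) * (1 + y ^ (2 * q + 2))) := by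
  rw [add_pow, Finset.sum_range_succ, Finset.sum_range_succ]
  have hrest : ∑ m ∈ Finset.range (2 * q + 1), s ^ m * y ^ (2 * q + 2 - m) *
      ((2 * q + 2).choose m : ℝ) ≤
      2 ^ (2 * q + 2) * ((1 + s ^ (2 * q)) * (1 + y ^ (2 * q + 2))) := by
    have he1 : |s| ^ (2 * q) = s ^ (2 * q) := (even_two_mul q).pow_abs s
    have he2 : |y| ^ (2 * q + 2) = y ^ (2 * q + 2) := (even_two_mul (q + 1)).pow_abs y
    have hn1 : 0 ≤ s ^ (2 * q) := he1 ▸ pow_nonneg (abs_nonneg s) _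
    have hn2 : 0 ≤ y ^ (2 * q + 2) := he2 ▸ pow_nonneg (abs_nonneg y) _
    have hterm : ∀ m ∈ Finset.range (2 * q + 1), s ^ m * y ^ (2 * q + 2 - m) *
        ((2 * q + 2).choose m : ℝ) ≤
        ((1 + s ^ (2 * q)) * (1 + y ^ (2 * q + 2))) * ((2 * q + 2).choose m : ℝ) := by
      intro m hm
      rw [Finset.mem_range] at hm
      refine mul_le_mul_of_nonneg_right ?_ (Nat.cast_nonneg _)
      refine (le_abs_self _).trans ?_
      rw [abs_mul, abs_pow, abs_pow, ← he1, ← he2]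
      exact mul_le_mul (abs_pow_le_one_add_abs_pow s (by omega))
        (abs_pow_le_one_add_abs_pow y (by omega)) (by positivity) (by positivity)
    refine (Finset.sum_le_sum hterm).trans ?_
    rw [← Finset.mul_sum, mul_comm]
    refine mul_le_mul_of_nonneg_right ?_ (by positivity)
    have h1 := Nat.sum_range_choose (2 * q + 2)
    rw [← Nat.cast_sum]
    have h2 : ∑ m ∈ Finset.range (2 * q + 1), (2 * q + 2).choose m ≤ 2 ^ (2 * q + 2) := by
      rw [← h1]
      exact Finset.sum_le_sum_of_subset (Finset.range_mono (by omega))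
    exact_mod_cast h2
  have h3 : 2 * q + 2 - (2 * q + 1) = 1 := by omega
  have h4 : (2 * q + 2).choose (2 * q + 1) = 2 * q + 2 := Nat.choose_succ_self_right (2 * q + 1)
  rw [h3, h4]
  simp only [pow_one, tsub_self, pow_zero, Nat.choose_self, Nat.cast_one, mul_one]
  push_cast
  linarith

variable {Ω : Type*} [MeasurableSpace Ω] {P : Measure Ω} [IsProbabilityMeasure P]

lemma MemLp.integrable_pow_of_le {f : Ω → ℝ} {n : ℕ} (hf : MemLp f n P) {k : ℕ} (hk : k ≤ n) :
    Integrable (fun ω => f ω ^ k) P := by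
  have h1 : MemLp f k P := hf.mono_exponent (by exact_mod_cast hk)
  refine (h1.integrable_norm_pow').mono' (hf.aestronglyMeasurable.pow k) ?_
  exact Filter.Eventually.of_forall fun ω => (norm_pow _ _).le

variable {ι : Type*} {Y : ι → Ω → ℝ} {K : ℝ}

/-- Even moments of sums of independent centred random variables. -/
lemma exists_integral_sum_pow_le (n : ℕ) (hL : ∀ i, MemLp (Y i) n P)
    (hm : ∀ i, Measurable (Y i)) (hind : iIndepFun Y P) (h0 : ∀ i, ∫ ω, Y i ω ∂P = 0)
    (hn : Even n) (hK : ∀ i, ∫ ω, Y i ω ^ n ∂P ≤ K) (q : ℕ) (hq : 2 * q ≤ n) :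
    ∃ C : ℝ, 0 ≤ C ∧ ∀ I : Finset ι,
      ∫ ω, (∑ i ∈ I, Y i ω) ^ (2 * q) ∂P ≤ C * (I.card + 1) ^ q := by
  classical
  induction q with
  | zero => exact ⟨1, zero_le_one, fun I => by simp⟩
  | succ q ih =>
    obtain ⟨C, hC, hI⟩ := ih (by omega)
    have hS : ∀ I : Finset ι, MemLp (fun ω => ∑ i ∈ I, Y i ω) n P := fun I =>
      memLp_finsetSum I fun i _ => hL i
    have hq : 2 * q + 2 ≤ n := hq
    have hY : ∀ i, ∫ ω, Y i ω ^ (2 * q + 2) ∂P ≤ 1 + K := by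
      intro i
      have : ∫ ω, Y i ω ^ (2 * q + 2) ∂P ≤ ∫ ω, (1 + Y i ω ^ n) ∂P := by
        refine integral_mono (MemLp.integrable_pow_of_le (hL i) hq)
          ((integrable_const _).add (MemLp.integrable_pow_of_le (hL i) le_rfl)) fun ω => ?_
        have := abs_pow_le_one_add_abs_pow (Y i ω) hq
        rw [hn.pow_abs] at this
        exact (even_two_mul (q + 1)).pow_abs (Y i ω) ▸ this
      rw [integral_add (integrable_const _) (MemLp.integrable_pow_of_le (hL i) le_rfl)] at this
      simp only [integral_const, probReal_univ, smul_eq_mul, mul_one] at this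
      linarith [hK i]
    -- An index is needed to know that K ≥ 0.
    rcases isEmpty_or_nonempty ι with hι | ⟨⟨i₀⟩⟩
    · exact ⟨0, le_rfl, fun I => by simp [Finset.eq_empty_of_isEmpty I]⟩
    have hK0 : 0 ≤ K := (integral_nonneg fun ω => hn.pow_nonneg _).trans (hK i₀)
    -- The three factors bound the binomial coefficients, the lower moment of the partial sum
    -- (induction on q) and the moment of the new summand. Each new index then raises the moment by
    -- at most D(|I|+1)^q, which sums to order q + 1.
    refine ⟨2 ^ (2 * q + 2) * ((1 + C) * (2 + K)), by positivity, fun I => ?_⟩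
    set D := 2 ^ (2 * q + 2) * ((1 + C) * (2 + K)) with hD
    have hD0 : 0 ≤ D := by positivity
    induction I using Finset.induction_on with
    | empty => simp [hD0]
    | insert a I ha ihI =>
      have hi : IndepFun (fun ω => ∑ i ∈ I, Y i ω) (Y a) P := by
        have := hind.indepFun_finsetSum_of_notMem hm ha
        convert this using 1
        ext ω; simp
      have i1 := MemLp.integrable_pow_of_le (hS I) hq
      have i2 : Integrable (fun ω => (∑ i ∈ I, Y i ω) ^ (2 * q + 1) * Y a ω) P :=
        (hi.comp (measurable_id.pow_const (2 * q + 1)) measurable_id).integrable_mul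
          (MemLp.integrable_pow_of_le (hS I) (by omega))
          (by simpa using MemLp.integrable_pow_of_le (hL a) (k := 1) (by omega))
      have e2 : ∫ ω, (∑ i ∈ I, Y i ω) ^ (2 * q + 1) * Y a ω ∂P = 0 := by
        have := (hi.comp (measurable_id.pow_const (2 * q + 1))
          measurable_id).integral_fun_mul_eq_mul_integral
          (MemLp.integrable_pow_of_le (hS I) (by omega)).aestronglyMeasurable
          (hm a).aestronglyMeasurable
        simp only [Function.comp_def, id, h0, mul_zero] at this
        exact this
      have j1 : Integrable (fun ω => 1 + (∑ i ∈ I, Y i ω) ^ (2 * q)) P :=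
        (integrable_const _).add (MemLp.integrable_pow_of_le (hS I) (by omega))
      have j2 : Integrable (fun ω => 1 + Y a ω ^ (2 * q + 2)) P :=
        (integrable_const _).add (MemLp.integrable_pow_of_le (hL a) hq)
      have hi3 : IndepFun (fun ω => 1 + (∑ i ∈ I, Y i ω) ^ (2 * q))
          (fun ω => 1 + Y a ω ^ (2 * q + 2)) P :=
        hi.comp (φ := fun s : ℝ => 1 + s ^ (2 * q)) (ψ := fun s : ℝ => 1 + s ^ (2 * q + 2))
          (by fun_prop) (by fun_prop)
      have i3 : Integrable (fun ω => (1 + (∑ i ∈ I, Y i ω) ^ (2 * q)) *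
          (1 + Y a ω ^ (2 * q + 2))) P := hi3.integrable_mul j1 j2
      have e3 := hi3.integral_fun_mul_eq_mul_integral j1.aestronglyMeasurable
        j2.aestronglyMeasurable
      have e4 : ∫ ω, (1 + (∑ i ∈ I, Y i ω) ^ (2 * q)) ∂P ≤ (1 + C) * (I.card + 1) ^ q := by
        rw [integral_add (integrable_const _) (MemLp.integrable_pow_of_le (hS I) (by omega))]
        simp only [integral_const, probReal_univ, smul_eq_mul, mul_one]
        have := hI I
        have h1 : (1 : ℝ) ≤ (I.card + 1) ^ q := one_le_pow₀ (by simp)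
        linarith
      have e5 : ∫ ω, (1 + Y a ω ^ (2 * q + 2)) ∂P ≤ 2 + K := by
        rw [integral_add (integrable_const _) (MemLp.integrable_pow_of_le (hL a) hq)]
        simp only [integral_const, probReal_univ, smul_eq_mul, mul_one]
        linarith [hY a]
      have e5' : 0 ≤ ∫ ω, (1 + Y a ω ^ (2 * q + 2)) ∂P :=
        integral_nonneg fun ω => add_nonneg zero_le_one ((even_two_mul (q + 1)).pow_nonneg _)
      have main : ∫ ω, (∑ i ∈ insert a I, Y i ω) ^ (2 * q + 2) ∂P ≤
          ∫ ω, (∑ i ∈ I, Y i ω) ^ (2 * q + 2) ∂P + D * (I.card + 1) ^ q := by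
        have m1 : ∫ ω, (∑ i ∈ insert a I, Y i ω) ^ (2 * q + 2) ∂P ≤
            ∫ ω, ((∑ i ∈ I, Y i ω) ^ (2 * q + 2) +
              (2 * q + 2) * ((∑ i ∈ I, Y i ω) ^ (2 * q + 1) * Y a ω) +
              2 ^ (2 * q + 2) * ((1 + (∑ i ∈ I, Y i ω) ^ (2 * q)) *
                (1 + Y a ω ^ (2 * q + 2)))) ∂P := by
          refine integral_mono (MemLp.integrable_pow_of_le (hS _) hq)
            ((i1.add (i2.const_mul _)).add (i3.const_mul _)) fun ω => ?_
          simp only [Finset.sum_insert ha]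
          rw [add_comm (Y a ω)]
          exact add_pow_even_le _ _ _
        have i12 : Integrable (fun ω => (∑ i ∈ I, Y i ω) ^ (2 * q + 2) +
            (2 * q + 2) * ((∑ i ∈ I, Y i ω) ^ (2 * q + 1) * Y a ω)) P := i1.add (i2.const_mul _)
        rw [integral_add i12 (i3.const_mul _),
          integral_add i1 (i2.const_mul _), integral_const_mul, integral_const_mul, e2, e3,
          mul_zero, add_zero] at m1
        refine m1.trans (add_le_add le_rfl ?_)
        rw [hD, mul_assoc]
        refine mul_le_mul_of_nonneg_left ?_ (by positivity)
        calc _ ≤ ((1 + C) * (I.card + 1) ^ q) * (2 + K) :=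
              mul_le_mul e4 e5 e5' (by positivity)
          _ = _ := by ring
      rw [Finset.card_insert_of_notMem ha]
      change ∫ ω, (∑ i ∈ insert a I, Y i ω) ^ (2 * q + 2) ∂P ≤ _
      refine main.trans ((add_le_add_left ihI _).trans ?_)
      have hp : (I.card + 1 : ℝ) ^ q ≤ (I.card + 1 + 1) ^ q :=
        pow_le_pow_left₀ (by positivity) (by linarith) q
      push_cast
      rw [pow_succ, pow_succ]
      nlinarith [mul_nonneg hD0 (mul_nonneg (sub_nonneg.2 hp)
        (show (0 : ℝ) ≤ I.card + 1 + 1 by positivity))]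

/-- Uniformity over all index sets of at most l elements allows windows from which one index has
been deleted. -/
lemma exists_lintegral_one_add_pow_le (hL : ∀ i, MemLp (Y i) (10 : ℕ) P)
    (hm : ∀ i, Measurable (Y i)) (hind : iIndepFun Y P) (h0 : ∀ i, ∫ ω, Y i ω ∂P = 0)
    (hK : ∀ i, ∫ ω, Y i ω ^ 10 ∂P ≤ K) {c : ℝ} (hc : 0 < c) :
    ∃ C : ℝ, 0 ≤ C ∧ ∀ (l : ℕ) (I : Finset ι), I.card ≤ l →
      ∫⁻ ω, ENNReal.ofReal ((1 + |∑ i ∈ I, Y i ω| / c) ^ 10) ∂P ≤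
        ENNReal.ofReal (C * (l + 1) ^ 5) := by
  obtain ⟨C, hC, h⟩ := exists_integral_sum_pow_le 10 hL hm hind h0 (by decide) hK 5 le_rfl
  refine ⟨2 ^ 9 * (1 + C / c ^ 10), by positivity, fun l I hI => ?_⟩
  have hS : MemLp (fun ω => ∑ i ∈ I, Y i ω) (10 : ℕ) P := memLp_finsetSum I fun i _ => hL i
  have hint := MemLp.integrable_pow_of_le hS le_rfl
  have hint' : Integrable (fun ω => 2 ^ 9 * (1 + (∑ i ∈ I, Y i ω) ^ 10 / c ^ 10)) P :=
    ((integrable_const _).add (hint.div_const _)).const_mul _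
  calc ∫⁻ ω, ENNReal.ofReal ((1 + |∑ i ∈ I, Y i ω| / c) ^ 10) ∂P
      ≤ ∫⁻ ω, ENNReal.ofReal (2 ^ 9 * (1 + (∑ i ∈ I, Y i ω) ^ 10 / c ^ 10)) ∂P := by
        refine lintegral_mono fun ω => ENNReal.ofReal_le_ofReal ?_
        have := add_pow_le zero_le_one (div_nonneg (abs_nonneg (∑ i ∈ I, Y i ω)) hc.le) 10
        rwa [one_pow, div_pow, Even.pow_abs (by decide)] at this
    _ = ENNReal.ofReal (∫ ω, 2 ^ 9 * (1 + (∑ i ∈ I, Y i ω) ^ 10 / c ^ 10) ∂P) := by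
        rw [ofReal_integral_eq_lintegral_ofReal hint']
        exact Filter.Eventually.of_forall fun ω => by
          have : 0 ≤ (∑ i ∈ I, Y i ω) ^ 10 := Even.pow_nonneg (by decide) _
          simp only [Pi.zero_apply]; positivity
    _ ≤ _ := by
        refine ENNReal.ofReal_le_ofReal ?_
        rw [integral_const_mul, integral_add (integrable_const _) (hint.div_const _),
          integral_div, mul_assoc]
        refine mul_le_mul_of_nonneg_left ?_ (by positivity)
        simp only [integral_const, probReal_univ, smul_eq_mul, mul_one]
        have h1 := h I
        have h2 : (I.card + 1 : ℝ) ^ 5 ≤ (l + 1) ^ 5 :=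
          pow_le_pow_left₀ (by positivity) (by have : (I.card : ℝ) ≤ l := by exact_mod_cast hI
                                               linarith) 5
        have h3 : (1 : ℝ) ≤ (l + 1) ^ 5 := one_le_pow₀ (by simp)
        have h4 : (∫ ω, (∑ i ∈ I, Y i ω) ^ 10 ∂P) / c ^ 10 ≤ C / c ^ 10 * (l + 1) ^ 5 := by
          rw [div_mul_eq_mul_div]
          refine div_le_div_of_nonneg_right (h1.trans ?_) (by positivity)
          exact mul_le_mul_of_nonneg_left h2 hC
        nlinarith

end Moments

/-! ### Joint independence of the initial value and all noise variables. -/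

section Independence

variable {Ω : Type*} {mΩ : MeasurableSpace Ω} {P : Measure Ω}

lemma iIndep_sumElim {ι κ : Type*} {m₁ : ι → MeasurableSpace Ω} {m₂ : κ → MeasurableSpace Ω}
    (h₁ : iIndep m₁ P) (h₂ : iIndep m₂ P) (h : Indep (⨆ i, m₁ i) (⨆ i, m₂ i) P) :
    iIndep (Sum.elim m₁ m₂) P := by
  rw [iIndep_iff]
  intro s f hf
  have hl : ∀ i ∈ s.toLeft, MeasurableSet[m₁ i] (f (Sum.inl i)) := fun i hi =>
    hf (Sum.inl i) (Finset.mem_toLeft.1 hi)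
  have hr : ∀ i ∈ s.toRight, MeasurableSet[m₂ i] (f (Sum.inr i)) := fun i hi =>
    hf (Sum.inr i) (Finset.mem_toRight.1 hi)
  have e : ⋂ i ∈ s, f i =
      (⋂ i ∈ s.toLeft, f (Sum.inl i)) ∩ ⋂ i ∈ s.toRight, f (Sum.inr i) := by
    ext ω
    simp only [Set.mem_iInter, Set.mem_inter_iff, Finset.mem_toLeft, Finset.mem_toRight]
    exact ⟨fun h => ⟨fun i hi => h _ hi, fun i hi => h _ hi⟩,
      fun h i hi => by rcases i with i | i; exacts [h.1 i hi, h.2 i hi]⟩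
  rw [e, (Indep_iff _ _ _).1 h _ _
    (Finset.measurableSet_biInter _ fun i hi => le_iSup m₁ i _ (hl i hi))
    (Finset.measurableSet_biInter _ fun i hi => le_iSup m₂ i _ (hr i hi)),
    h₁.meas_biInter hl, h₂.meas_biInter hr]
  conv_rhs => rw [← Finset.toLeft_disjSum_toRight (u := s)]
  rw [Finset.prod_disjSum]

lemma iIndep_unit [IsProbabilityMeasure P] (m : Unit → MeasurableSpace Ω) : iIndep m P := by
  rw [iIndep_iff]
  intro s f _
  rcases s.eq_empty_or_nonempty with rfl | ⟨a, ha⟩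
  · simp
  · have : s = {()} := by
      ext b; exact ⟨fun _ => by simp, fun _ => ha⟩
    rw [this, Finset.prod_singleton, Finset.set_biInter_singleton]

variable {V : Type*} [MeasurableSpace V]

/-- The σ-algebras generated by the initial value and by the individual noise variables. -/
abbrev noiseAlgebra (x : Ω → V) (η : ℕ → Ω → V) (β : ℕ → Ω → ℝ) :
    Unit ⊕ (ℕ ⊕ ℕ) → MeasurableSpace Ω :=
  Sum.elim (fun _ => MeasurableSpace.comap x inferInstance)
    (Sum.elim (fun k => MeasurableSpace.comap (η k) inferInstance)
      (fun k => MeasurableSpace.comap (β k) inferInstance))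

variable {x : Ω → V} {η : ℕ → Ω → V} {β : ℕ → Ω → ℝ}

lemma noiseAlgebra_le (hx : Measurable x) (hη : ∀ k, Measurable (η k))
    (hβ : ∀ k, Measurable (β k)) (i : Unit ⊕ (ℕ ⊕ ℕ)) : noiseAlgebra x η β i ≤ mΩ := by
  rcases i with _ | k | k
  · exact hx.comap_le
  · exact (hη k).comap_le
  · exact (hβ k).comap_le

/-- A single independent family indexed by x, the η's and the β's reduces every later independence
claim to disjointness of index sets. -/
lemma iIndep_noiseAlgebra [IsProbabilityMeasure P] (hβ : iIndepFun β P) (hη : iIndepFun η P)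
    (hηβ : IndepFun (fun ω m => η m ω) (fun ω m => β m ω) P)
    (hx : IndepFun x (fun ω => ((fun m => β m ω), (fun m => η m ω))) P) :
    iIndep (noiseAlgebra x η β) P := by
  refine iIndep_sumElim (iIndep_unit _) (iIndep_sumElim ?_ ?_ ?_) ?_
  · exact (iIndepFun_iff_iIndep _ _ _).1 hη
  · exact (iIndepFun_iff_iIndep _ _ _).1 hβ
  · refine indep_of_indep_of_le_left (indep_of_indep_of_le_right hηβ ?_) ?_
    · refine iSup_le fun k => ?_
      rw [← measurable_iff_comap_le]
      exact (measurable_pi_apply k).comp (comap_measurable (fun ω m => β m ω))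
    · refine iSup_le fun k => ?_
      rw [← measurable_iff_comap_le]
      exact (measurable_pi_apply k).comp (comap_measurable (fun ω m => η m ω))
  · refine indep_of_indep_of_le_left (indep_of_indep_of_le_right hx ?_) ?_
    · refine iSup_le fun k => ?_
      rcases k with k | k
      · simp only [Sum.elim_inl]
        rw [← measurable_iff_comap_le]
        exact ((measurable_pi_apply k).comp measurable_snd).comp
          (comap_measurable (fun ω => ((fun m => β m ω), (fun m => η m ω))))
      · simp only [Sum.elim_inr]
        rw [← measurable_iff_comap_le]
        exact ((measurable_pi_apply k).comp measurable_fst).comp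
          (comap_measurable (fun ω => ((fun m => β m ω), (fun m => η m ω))))
    · exact iSup_le fun _ => le_rfl

lemma lintegral_mul_of_iIndep {ι : Type*} {m : ι → MeasurableSpace Ω} (hle : ∀ i, m i ≤ mΩ)
    (hm : iIndep m P) {S T : Set ι} (hST : Disjoint S T) {f g : Ω → ENNReal}
    (hf : Measurable[⨆ i ∈ S, m i] f) (hg : Measurable[⨆ i ∈ T, m i] g) :
    ∫⁻ ω, f ω * g ω ∂P = (∫⁻ ω, f ω ∂P) * ∫⁻ ω, g ω ∂P :=
  lintegral_mul_eq_lintegral_mul_lintegral_of_independent_measurableSpace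
    (iSup₂_le fun i _ => hle i) (iSup₂_le fun i _ => hle i) (indep_iSup_of_disjoint hle hm hST) hf hg

lemma measurable_iSup_of_mem {ι γ : Type*} [MeasurableSpace γ] {m : ι → MeasurableSpace Ω}
    {S : Set ι} {i : ι} (hi : i ∈ S) {f : Ω → γ} (hf : Measurable[m i] f) :
    Measurable[⨆ i ∈ S, m i] f :=
  hf.mono (le_iSup₂ (f := fun i (_ : i ∈ S) => m i) i hi) le_rfl

lemma measurable_noise_eta {S : Set (Unit ⊕ (ℕ ⊕ ℕ))} {k : ℕ} (h : Sum.inr (Sum.inl k) ∈ S) :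
    Measurable[⨆ i ∈ S, noiseAlgebra x η β i] (η k) :=
  measurable_iSup_of_mem (m := noiseAlgebra x η β) h (comap_measurable (η k))

lemma measurable_noise_beta {S : Set (Unit ⊕ (ℕ ⊕ ℕ))} {k : ℕ} (h : Sum.inr (Sum.inr k) ∈ S) :
    Measurable[⨆ i ∈ S, noiseAlgebra x η β i] (β k) :=
  measurable_iSup_of_mem (m := noiseAlgebra x η β) h (comap_measurable (β k))

lemma measurable_noise_init {S : Set (Unit ⊕ (ℕ ⊕ ℕ))} (h : Sum.inl () ∈ S) :
    Measurable[⨆ i ∈ S, noiseAlgebra x η β i] x :=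
  measurable_iSup_of_mem (m := noiseAlgebra x η β) h (comap_measurable x)

end Independence

/-! ### Extinction indices. -/

section Extinction

variable {Ω V : Type*} [NormedAddCommGroup V] [NormedSpace ℝ V] {A : V → Set V} {η : ℕ → Ω → V}
  {x : Ω → V} {β : ℕ → Ω → ℝ}

lemma arrival_strictMono (hβ0 : ∀ k ω, 0 < β k ω) (ω : Ω) : StrictMono fun k => arrival β k ω :=
  strictMono_nat_of_lt_succ fun k => by
    simp only [arrival, Finset.sum_range_succ]; linarith [hβ0 k ω]

/-- Replaces the infimum in ℕ∞ by a finite search. With k counted from 0 the candidate index is k +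
1, so the strict inequality becomes `≤ k`. -/
lemma extinctionIndex_succ_le_iff (n j : ℕ) (ω : Ω) :
    extinctionIndex A β η x (n + 1) ω ≤ j ↔
      ∃ k < j, semigroup A (β k ω) (genSeq A β η x k ω) = 0 ∧ extinctionIndex A β η x n ω ≤ k := by
  have key : ∀ (a : ℕ∞) (k : ℕ), a < ((k + 1 : ℕ) : ℕ∞) ↔ a ≤ k := by
    intro a k
    push_cast
    exact ENat.lt_add_one_iff (ENat.natCast_ne_top k)
  simp only [extinctionIndex]
  constructor
  · intro h
    set S := {m : ℕ∞ | ∃ k : ℕ, m = ((k + 1 : ℕ) : ℕ∞) ∧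
      semigroup A (β k ω) (genSeq A β η x k ω) = 0 ∧ extinctionIndex A β η x n ω < m} with hS
    have hne : S.Nonempty := by
      by_contra hne
      rw [Set.not_nonempty_iff_eq_empty] at hne
      rw [hne, sInf_empty, top_le_iff] at h
      exact ENat.natCast_ne_top j h
    obtain ⟨k, hk, h1, h2⟩ := csInf_mem hne
    refine ⟨k, ?_, h1, ?_⟩
    · rw [hk] at h
      exact Nat.cast_le.1 h
    · rw [hk] at h2
      exact (key _ _).1 h2
  · rintro ⟨k, hk, h1, h2⟩
    exact (sInf_le (Set.mem_ofPred_eq ▸ ⟨k, rfl, h1, (key _ _).2 h2⟩)).trans (Nat.cast_le.2 hk)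

end Extinction

/-! ### Which noise variables determine the sequence and the extinction indices. -/

section Measurability

variable {Ω V : Type*} {m : MeasurableSpace Ω} [NormedAddCommGroup V] [NormedSpace ℝ V]
  [CompleteSpace V] [SecondCountableTopology V] [MeasurableSpace V] [BorelSpace V]
  {A : V → Set V} {β : ℕ → Ω → ℝ} {η : ℕ → Ω → V} {x : Ω → V}

lemma measurable_semigroup_comp (hA : Accretive A) (hD : DenselyDefined A) {b : Ω → ℝ} {X : Ω → V}
    (hb : Measurable b) (hb0 : ∀ ω, 0 ≤ b ω) (hX : Measurable X) :
    Measurable fun ω => semigroup A (b ω) (X ω) := by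
  have := (measurable_semigroup hA hD).comp (hb.prodMk hX)
  simpa only [Function.comp_def, fun ω => max_eq_left (hb0 ω)] using this

lemma measurable_genSeq (hA : Accretive A) (hD : DenselyDefined A) (hβ0 : ∀ k ω, 0 < β k ω)
    (hx : Measurable x) (k : ℕ) (hη : ∀ i < k, Measurable (η i)) (hβ : ∀ i < k, Measurable (β i)) :
    Measurable (genSeq A β η x k) := by
  induction k with
  | zero => exact hx
  | succ k ih =>
    exact (measurable_semigroup_comp hA hD (hβ k (by omega)) (fun ω => (hβ0 k ω).le)
      (ih (fun i hi => hη i (by omega)) (fun i hi => hβ i (by omega)))).add (hη k (by omega))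

/-- The σ-algebra on Ω is arbitrary, so this applies to sub-σ-algebras of the noise. The asymmetric
ranges are essential: T(β_k)X_k involves β up to k but η only up to k - 1, so the jump added at the
extinction itself remains independent of the event. -/
lemma measurableSet_extinctionIndex_le (hA : Accretive A) (hD : DenselyDefined A)
    (hβ0 : ∀ k ω, 0 < β k ω) (hx : Measurable x) (n j : ℕ)
    (hη : ∀ i, i + 1 < j → Measurable (η i)) (hβ : ∀ i < j, Measurable (β i)) :
    MeasurableSet {ω | extinctionIndex A β η x n ω ≤ j} := by
  induction n generalizing j with
  | zero => simp [extinctionIndex]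
  | succ n ih =>
    have e : {ω | extinctionIndex A β η x (n + 1) ω ≤ j} = ⋃ k ∈ Finset.range j,
        ({ω | semigroup A (β k ω) (genSeq A β η x k ω) = 0} ∩
          {ω | extinctionIndex A β η x n ω ≤ k}) := by
      ext ω
      simp only [Set.mem_ofPred_eq, extinctionIndex_succ_le_iff, Set.mem_iUnion, Finset.mem_range,
        Set.mem_inter_iff, exists_prop]
    rw [e]
    refine Finset.measurableSet_biUnion _ fun k hk => ?_
    rw [Finset.mem_range] at hk
    refine MeasurableSet.inter ?_ (ih k (fun i hi => hη i (by omega)) (fun i hi => hβ i (by omega)))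
    exact measurable_semigroup_comp hA hD (hβ k hk) (fun ω => (hβ0 k ω).le)
      (measurable_genSeq hA hD hβ0 hx k (fun i hi => hη i (by omega))
        (fun i hi => hβ i (by omega))) (measurableSet_singleton 0)

lemma measurableSet_extinctionIndex_eq (hA : Accretive A) (hD : DenselyDefined A)
    (hβ0 : ∀ k ω, 0 < β k ω) (hx : Measurable x) (n j : ℕ)
    (hη : ∀ i, i + 1 < j → Measurable (η i)) (hβ : ∀ i < j, Measurable (β i)) :
    MeasurableSet {ω | extinctionIndex A β η x n ω = j} := by
  have h1 := measurableSet_extinctionIndex_le hA hD hβ0 hx n j hη hβ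
  rcases j with _ | j
  · simpa using h1
  · have h2 := measurableSet_extinctionIndex_le hA hD hβ0 hx n j (fun i hi => hη i (by omega))
      (fun i hi => hβ i (by omega))
    convert h1.diff h2 using 1
    ext ω
    simp only [Set.mem_ofPred_eq, Set.mem_sdiff, not_le]
    constructor
    · intro h
      rw [h]
      exact ⟨le_rfl, by exact_mod_cast Nat.lt_succ_self j⟩
    · rintro ⟨h3, h4⟩
      refine le_antisymm h3 ?_
      push_cast
      exact Order.add_one_le_of_lt h4

end Measurability

/-! ### Norms of embedded subspaces. -/

section EmbNorm

variable {V' V : Type*} [NormedAddCommGroup V'] [NormedSpace ℝ V'] [NormedAddCommGroup V]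
  [NormedSpace ℝ V] {ι : V' →L[ℝ] V}

lemma embNorm_nonneg (u : V) : 0 ≤ embNorm ι u := by
  rw [embNorm]; split_ifs; exacts [norm_nonneg _, le_rfl]

lemma embNorm_apply (hι : Function.Injective ι) (v : V') : embNorm ι (ι v) = ‖v‖ := by
  rw [embNorm, if_pos ⟨v, rfl⟩, Function.leftInverse_invFun hι]

lemma embNorm_add_le (hι : Function.Injective ι) {u v : V} (hu : u ∈ Set.range ι)
    (hv : v ∈ Set.range ι) : embNorm ι (u + v) ≤ embNorm ι u + embNorm ι v := by
  obtain ⟨a, rfl⟩ := hu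
  obtain ⟨b, rfl⟩ := hv
  rw [← map_add, embNorm_apply hι, embNorm_apply hι, embNorm_apply hι]
  exact norm_add_le a b

lemma eq_zero_of_embNorm_eq_zero (hι : Function.Injective ι) {u : V} (hu : u ∈ Set.range ι)
    (h : embNorm ι u = 0) : u = 0 := by
  obtain ⟨a, rfl⟩ := hu
  rw [embNorm_apply hι, norm_eq_zero] at h
  rw [h, map_zero]

lemma add_mem_range {u v : V} (hu : u ∈ Set.range ι) (hv : v ∈ Set.range ι) :
    u + v ∈ Set.range ι := by
  obtain ⟨a, rfl⟩ := hu
  obtain ⟨b, rfl⟩ := hv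
  exact ⟨a + b, map_add _ _ _⟩

/-- By the Lusin–Souslin theorem a continuous injection of a Polish space is a Borel embedding, so
the norm extended by zero is Borel on V. -/
lemma measurable_embNorm [CompleteSpace V'] [TopologicalSpace.SeparableSpace V']
    [MeasurableSpace V] [BorelSpace V] (hι : Function.Injective ι) : Measurable (embNorm ι) := by
  borelize V'
  have : SecondCountableTopology V' := UniformSpace.secondCountable_of_separable V'
  have he : MeasurableEmbedding ι := ι.continuous.measurableEmbedding hι
  convert he.measurable_extend measurable_norm (measurable_const (a := (0 : ℝ))) using 1
  ext u
  by_cases hu : u ∈ Set.range ι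
  · obtain ⟨v, rfl⟩ := hu
    rw [embNorm_apply hι, hι.extend_apply]
  · rw [embNorm, if_neg hu, Function.extend_apply' _ _ _ hu]

end EmbNorm

/-! ### Pathwise estimates along the generated sequence. -/

section Pathwise

variable {V V₁ V₂ Ω : Type*} [NormedAddCommGroup V] [NormedSpace ℝ V]
  [NormedAddCommGroup V₁] [NormedSpace ℝ V₁] [NormedAddCommGroup V₂] [NormedSpace ℝ V₂]
  {A : V → Set V} {ι₁ : V₁ →L[ℝ] V} {ι₂ : V₂ →L[ℝ] V} {κ ρ : ℝ}
  {β : ℕ → Ω → ℝ} {η : ℕ → Ω → V} {x : Ω → V} {ω : Ω}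

lemma SemigroupAssumption.extinction' (hT : SemigroupAssumption A ι₁ ι₂ κ ρ)
    (hι₁ : Function.Injective ι₁) {t : ℝ} (ht : 0 ≤ t) {u : V} (hu : u ∈ Set.range ι₁) :
    embNorm ι₁ (semigroup A t u) ^ ρ ≤ max (embNorm ι₁ u ^ ρ - κ * t) 0 := by
  obtain ⟨v, rfl⟩ := hu
  rw [embNorm_apply hι₁]
  convert hT.extinction t ht v using 2
  ring

lemma SemigroupAssumption.lt_of_ne_zero (hT : SemigroupAssumption A ι₁ ι₂ κ ρ)
    (hι₁ : Function.Injective ι₁) {t : ℝ} (ht : 0 ≤ t) {u : V} (hu : u ∈ Set.range ι₁)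
    (h : semigroup A t u ≠ 0) : κ * t < embNorm ι₁ u ^ ρ := by
  by_contra hlt
  refine h (eq_zero_of_embNorm_eq_zero hι₁ ?_ ?_)
  · obtain ⟨v, rfl⟩ := hu
    exact hT.invariant₁ t ht v
  · have h1 := hT.extinction' hι₁ ht hu
    rw [max_eq_right (by linarith)] at h1
    have h2 := le_antisymm h1 (Real.rpow_nonneg (embNorm_nonneg _) ρ)
    exact (Real.rpow_eq_zero (embNorm_nonneg _) hT.rho_pos.ne').1 h2

lemma SemigroupAssumption.contraction' (hT : SemigroupAssumption A ι₁ ι₂ κ ρ)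
    (hι₂ : Function.Injective ι₂) {t : ℝ} (ht : 0 ≤ t) {u : V} (hu : u ∈ Set.range ι₂) :
    embNorm ι₂ (semigroup A t u) ≤ embNorm ι₂ u := by
  obtain ⟨v, rfl⟩ := hu
  rw [embNorm_apply hι₂]
  exact hT.contraction t ht v

lemma SemigroupAssumption.genSeq_mem₁ (hT : SemigroupAssumption A ι₁ ι₂ κ ρ)
    (hβ : ∀ k ω, 0 < β k ω) (hx : x ω ∈ Set.range ι₁) (hη : ∀ k, η k ω ∈ Set.range ι₁) (k : ℕ) :
    genSeq A β η x k ω ∈ Set.range ι₁ := by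
  induction k with
  | zero => exact hx
  | succ k ih =>
    obtain ⟨v, hv⟩ := ih
    refine add_mem_range ?_ (hη k)
    rw [← hv]
    exact hT.invariant₁ _ (hβ k ω).le v

lemma SemigroupAssumption.genSeq_mem₂ (hT : SemigroupAssumption A ι₁ ι₂ κ ρ)
    (hβ : ∀ k ω, 0 < β k ω) (hx : x ω ∈ Set.range ι₂) (hη : ∀ k, η k ω ∈ Set.range ι₂) (k : ℕ) :
    genSeq A β η x k ω ∈ Set.range ι₂ := by
  induction k with
  | zero => exact hx
  | succ k ih =>
    obtain ⟨v, hv⟩ := ih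
    refine add_mem_range ?_ (hη k)
    rw [← hv]
    exact hT.invariant₂ _ (hβ k ω).le v

/-- As long as there is no extinction, `‖X_m‖_{V₁}^ρ` is dominated by a random walk. -/
lemma SemigroupAssumption.embNorm_genSeq_le_walk (hT : SemigroupAssumption A ι₁ ι₂ κ ρ)
    (hι₁ : Function.Injective ι₁) (hβ : ∀ k ω, 0 < β k ω) (hx : x ω ∈ Set.range ι₁)
    (hη : ∀ k, η k ω ∈ Set.range ι₁) (N l : ℕ)
    (hne : ∀ i < l, semigroup A (β (N + i) ω) (genSeq A β η x (N + i) ω) ≠ 0) :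
    embNorm ι₁ (genSeq A β η x (N + l) ω) ^ ρ ≤ embNorm ι₁ (genSeq A β η x N ω) ^ ρ +
      ∑ i ∈ Finset.range l, (embNorm ι₁ (η (N + i) ω) ^ ρ - κ * β (N + i) ω) := by
  induction l with
  | zero => simp
  | succ l ih =>
    have h1 := ih fun i hi => hne i (by omega)
    have hX := hT.genSeq_mem₁ hβ hx hη (N + l)
    have h2 := hT.lt_of_ne_zero hι₁ (hβ (N + l) ω).le hX (hne l (by omega))
    have h3 := hT.extinction' hι₁ (hβ (N + l) ω).le hX
    -- Absence of extinction means that the maximum is not attained by 0; afterwards subadditivity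
    -- of s ↦ s^ρ adds the jump.
    rw [max_eq_left (by linarith)] at h3
    have hTX : semigroup A (β (N + l) ω) (genSeq A β η x (N + l) ω) ∈ Set.range ι₁ := by
      obtain ⟨v, hv⟩ := hX
      rw [← hv]
      exact hT.invariant₁ _ (hβ _ ω).le v
    have h4 : embNorm ι₁ (genSeq A β η x (N + (l + 1)) ω) ^ ρ ≤
        embNorm ι₁ (semigroup A (β (N + l) ω) (genSeq A β η x (N + l) ω)) ^ ρ +
          embNorm ι₁ (η (N + l) ω) ^ ρ :=
      (Real.rpow_le_rpow (embNorm_nonneg _) (embNorm_add_le hι₁ hTX (hη (N + l)))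
        hT.rho_pos.le).trans (Real.rpow_add_le_add_rpow (embNorm_nonneg _) (embNorm_nonneg _)
          hT.rho_pos.le hT.rho_lt_one.le)
    rw [Finset.sum_range_succ]
    linarith

/-- Extinction resets the sequence to the jump η_j; from there the flow does not increase the
V₂-norm and each step adds one jump. -/
lemma SemigroupAssumption.embNorm_genSeq_le_sum (hT : SemigroupAssumption A ι₁ ι₂ κ ρ)
    (hι₂ : Function.Injective ι₂) (hβ : ∀ k ω, 0 < β k ω) (hx : x ω ∈ Set.range ι₂)
    (hη : ∀ k, η k ω ∈ Set.range ι₂) (j l : ℕ)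
    (h0 : semigroup A (β j ω) (genSeq A β η x j ω) = 0) :
    embNorm ι₂ (genSeq A β η x (j + 1 + l) ω) ≤
      ∑ k ∈ Finset.range (l + 1), embNorm ι₂ (η (j + k) ω) := by
  induction l with
  | zero => simp [genSeq, h0]
  | succ l ih =>
    have hX := hT.genSeq_mem₂ hβ hx hη (j + 1 + l)
    have h3 := hT.contraction' hι₂ (hβ (j + 1 + l) ω).le hX
    have hTX : semigroup A (β (j + 1 + l) ω) (genSeq A β η x (j + 1 + l) ω) ∈ Set.range ι₂ := by
      obtain ⟨v, hv⟩ := hX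
      rw [← hv]
      exact hT.invariant₂ _ (hβ _ ω).le v
    have h4 := embNorm_add_le hι₂ hTX (hη (j + 1 + l))
    rw [Finset.sum_range_succ, show j + (l + 1) = j + 1 + l by ring]
    change embNorm ι₂ (semigroup A (β (j + 1 + l) ω) (genSeq A β η x (j + 1 + l) ω) +
      η (j + 1 + l) ω) ≤ _
    linarith

/-- After an extinction, the next one has not occurred yet only if the random walk is
nonnegative. -/
lemma SemigroupAssumption.walk_nonneg (hT : SemigroupAssumption A ι₁ ι₂ κ ρ)
    (hι₁ : Function.Injective ι₁) (hβ : ∀ k ω, 0 < β k ω) (hx : x ω ∈ Set.range ι₁)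
    (hη : ∀ k, η k ω ∈ Set.range ι₁) (j l : ℕ)
    (h0 : semigroup A (β j ω) (genSeq A β η x j ω) = 0)
    (hne : ∀ i < l, semigroup A (β (j + 1 + i) ω) (genSeq A β η x (j + 1 + i) ω) ≠ 0) :
    κ * ∑ i ∈ Finset.range l, β (j + 1 + i) ω ≤
      ∑ i ∈ Finset.range l, embNorm ι₁ (η (j + i) ω) ^ ρ := by
  rcases l with _ | l
  · simp
  · have h1 := hT.embNorm_genSeq_le_walk hι₁ hβ hx hη (j + 1) l fun i hi => hne i (by omega)
    -- The walk comparison uses only the first l waiting times; survival over the last one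
    -- contributes the remaining β. The jump η_j enters as the initial value, hence the index shift
    -- between η and β.
    have h2 := hT.lt_of_ne_zero hι₁ (hβ (j + 1 + l) ω).le (hT.genSeq_mem₁ hβ hx hη (j + 1 + l))
      (hne l (by omega))
    have h3 : genSeq A β η x (j + 1) ω = η j ω := by simp [genSeq, h0]
    rw [h3, Finset.sum_sub_distrib, ← Finset.mul_sum] at h1
    rw [Finset.sum_range_succ, Finset.sum_range_succ' _ l]
    simp only [add_zero]
    have h4 : ∑ i ∈ Finset.range l, embNorm ι₁ (η (j + (i + 1)) ω) ^ ρ =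
        ∑ i ∈ Finset.range l, embNorm ι₁ (η (j + 1 + i) ω) ^ ρ :=
      Finset.sum_congr rfl fun i _ => by rw [show j + (i + 1) = j + 1 + i by ring]
    rw [h4]
    linarith

/-- Pathwise finiteness of all extinction indices. -/
lemma SemigroupAssumption.extinctionIndex_lt_top (hT : SemigroupAssumption A ι₁ ι₂ κ ρ)
    (hι₁ : Function.Injective ι₁) (hβ : ∀ k ω, 0 < β k ω) (hx : x ω ∈ Set.range ι₁)
    (hη : ∀ k, η k ω ∈ Set.range ι₁)
    (hwalk : Filter.Tendsto (fun n => ∑ i ∈ Finset.range n,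
      (embNorm ι₁ (η i ω) ^ ρ - κ * β i ω)) Filter.atTop Filter.atBot) (n : ℕ) :
    extinctionIndex A β η x n ω < ⊤ := by
  induction n with
  | zero => simp [extinctionIndex]
  | succ n ih =>
    obtain ⟨N, hN⟩ := ENat.ne_top_iff_exists.1 ih.ne
    have hex : ∃ l, semigroup A (β (N + l) ω) (genSeq A β η x (N + l) ω) = 0 := by
      by_contra! hne
      have h1 := fun l => hT.embNorm_genSeq_le_walk hι₁ hβ hx hη N l fun i _ => hne i
      -- The threshold is chosen to make the upper bound for ‖X_{N+l}‖^ρ at most -1, a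
      -- contradiction.
      have h2 := Filter.tendsto_atBot.1 (hwalk.comp (Filter.tendsto_add_atTop_nat N))
        (∑ i ∈ Finset.range N, (embNorm ι₁ (η i ω) ^ ρ - κ * β i ω) -
          embNorm ι₁ (genSeq A β η x N ω) ^ ρ - 1)
      obtain ⟨l, hl⟩ := h2.exists
      simp only [Function.comp_apply] at hl
      rw [add_comm l N, Finset.sum_range_add] at hl
      have h3 := Real.rpow_nonneg (embNorm_nonneg (ι := ι₁) (genSeq A β η x (N + l) ω)) ρ
      have h4 := h1 l
      linarith
    obtain ⟨l, hl⟩ := hex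
    have : extinctionIndex A β η x (n + 1) ω ≤ ((N + l + 1 : ℕ) : ℕ∞) := by
      rw [extinctionIndex_succ_le_iff]
      refine ⟨N + l, by omega, hl, ?_⟩
      rw [← hN]
      exact Nat.cast_le.2 (by omega)
    exact this.trans_lt (ENat.natCast_lt_top _)

lemma exists_of_extinctionIndex_succ_eq {n M : ℕ}
    (hM : extinctionIndex A β η x (n + 1) ω = M) :
    ∃ j, M = j + 1 ∧ semigroup A (β j ω) (genSeq A β η x j ω) = 0 ∧
      extinctionIndex A β η x n ω ≤ j ∧ ∀ k : ℕ, extinctionIndex A β η x n ω ≤ k → k < j →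
        semigroup A (β k ω) (genSeq A β η x k ω) ≠ 0 := by
  obtain ⟨j, hj, h1, h2⟩ := (extinctionIndex_succ_le_iff n M ω).1 hM.le
  have hmin : ∀ k : ℕ, extinctionIndex A β η x n ω ≤ k → k + 1 < M →
      semigroup A (β k ω) (genSeq A β η x k ω) ≠ 0 := by
    intro k hk hkM h
    have : extinctionIndex A β η x (n + 1) ω ≤ ((k + 1 : ℕ) : ℕ∞) :=
      (extinctionIndex_succ_le_iff n (k + 1) ω).2 ⟨k, by omega, h, hk⟩
    rw [hM] at this
    have := Nat.cast_le.1 this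
    omega
  have hMj : M = j + 1 := by
    by_contra hne
    exact hmin j h2 (by omega) h1
  exact ⟨j, hMj, h1, h2, fun k hk hkj => hmin k hk (by omega)⟩

lemma genProcess_eq (hβ : ∀ k ω, 0 < β k ω) {m : ℕ} {t : ℝ}
    (ht : t ∈ Set.Ico (arrival β m ω) (arrival β (m + 1) ω)) :
    genProcess A β η x t ω = semigroup A (t - arrival β m ω) (genSeq A β η x m ω) := by
  rw [genProcess, tsum_eq_single m]
  · rw [Set.indicator_of_mem ht, max_eq_left (sub_nonneg.2 ht.1)]
  · intro k hk
    refine Set.indicator_of_notMem (fun hk' => hk ?_) _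
    have hmono := arrival_strictMono hβ ω
    have h1 : arrival β m ω < arrival β (k + 1) ω := ht.1.trans_lt hk'.2
    have h2 : arrival β k ω < arrival β (m + 1) ω := hk'.1.trans_lt ht.2
    have h3 := hmono.lt_iff_lt.1 h1
    have h4 := hmono.lt_iff_lt.1 h2
    omega

/-- At most one term is nonzero, so the sum converges at every t; this exhibits the process as a
pointwise limit of measurable partial sums. -/
lemma hasSum_genProcess (hβ : ∀ k ω, 0 < β k ω) (t : ℝ) :
    HasSum (fun m => (Set.Ico (arrival β m ω) (arrival β (m + 1) ω)).indicator
      (fun s => semigroup A (max (s - arrival β m ω) 0) (genSeq A β η x m ω)) t)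
      (genProcess A β η x t ω) := by
  refine Summable.hasSum ?_
  by_cases h : ∃ m, t ∈ Set.Ico (arrival β m ω) (arrival β (m + 1) ω)
  · obtain ⟨m, ht⟩ := h
    refine summable_of_ne_finset_zero (s := {m}) fun k hk => ?_
    rw [Finset.mem_singleton] at hk
    refine Set.indicator_of_notMem (fun hk' => hk ?_) _
    have hmono := arrival_strictMono hβ ω
    have h3 := hmono.lt_iff_lt.1 (ht.1.trans_lt hk'.2)
    have h4 := hmono.lt_iff_lt.1 (hk'.1.trans_lt ht.2)
    omega
  · simp only [not_exists] at h
    exact summable_of_ne_finset_zero (s := ∅) fun k _ => Set.indicator_of_notMem (h k) _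

variable {W : Type*} [NormedAddCommGroup W] {Ξ : V → W} {c₁ c₂ : ℝ}

lemma SemigroupAssumption.norm_apply_genProcess_le (hT : SemigroupAssumption A ι₁ ι₂ κ ρ)
    (hι₂ : Function.Injective ι₂) (hβ : ∀ k ω, 0 < β k ω) (hx : x ω ∈ Set.range ι₂)
    (hη : ∀ k, η k ω ∈ Set.range ι₂) (hc₁ : 0 ≤ c₁)
    (hΞ : ∀ v : V₂, ‖Ξ (ι₂ v)‖ ≤ c₁ * ‖v‖ + c₂) {m : ℕ} {t : ℝ}
    (ht : t ∈ Set.Ico (arrival β m ω) (arrival β (m + 1) ω)) :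
    ‖Ξ (genProcess A β η x t ω)‖ ≤ c₁ * embNorm ι₂ (genSeq A β η x m ω) + c₂ := by
  rw [genProcess_eq hβ ht]
  have hX := hT.genSeq_mem₂ hβ hx hη m
  have hs := sub_nonneg.2 ht.1
  have h1 := hT.contraction' hι₂ hs hX
  obtain ⟨u, hu⟩ : semigroup A (t - arrival β m ω) (genSeq A β η x m ω) ∈ Set.range ι₂ := by
    obtain ⟨v, hv⟩ := hX
    rw [← hv]
    exact hT.invariant₂ _ hs v
  have h2 := hΞ u
  rw [← hu, embNorm_apply hι₂] at h1
  rw [← hu]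
  exact h2.trans (add_le_add_left (mul_le_mul_of_nonneg_left h1 hc₁) _)

variable [NormedSpace ℝ W]

lemma SemigroupAssumption.piece_integral (hT : SemigroupAssumption A ι₁ ι₂ κ ρ)
    (hι₂ : Function.Injective ι₂) (hβ : ∀ k ω, 0 < β k ω) (hx : x ω ∈ Set.range ι₂)
    (hη : ∀ k, η k ω ∈ Set.range ι₂) (hc₁ : 0 ≤ c₁)
    (hΞ : ∀ v : V₂, ‖Ξ (ι₂ v)‖ ≤ c₁ * ‖v‖ + c₂)
    (hmeas : AEStronglyMeasurable (fun t => Ξ (genProcess A β η x t ω)) volume) (m : ℕ) :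
    IntervalIntegrable (fun t => Ξ (genProcess A β η x t ω)) volume (arrival β m ω)
      (arrival β (m + 1) ω) ∧
    ‖∫ t in (arrival β m ω)..(arrival β (m + 1) ω), Ξ (genProcess A β η x t ω)‖ ≤
      (c₁ * embNorm ι₂ (genSeq A β η x m ω) + c₂) * β m ω := by
  have hle : arrival β m ω ≤ arrival β (m + 1) ω := (arrival_strictMono hβ ω).monotone (by omega)
  have hbound : ∀ᵐ t, t ∈ Set.uIoc (arrival β m ω) (arrival β (m + 1) ω) →
      ‖Ξ (genProcess A β η x t ω)‖ ≤ c₁ * embNorm ι₂ (genSeq A β η x m ω) + c₂ := by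
    -- Interval integrals run over (a, b] whereas the pieces of the process live on [a, b); the
    -- right endpoint is a null set.
    have hne : ∀ᵐ t : ℝ, t ≠ arrival β (m + 1) ω := by
      simp [ae_iff]
    filter_upwards [hne] with t ht htm
    rw [Set.uIoc_of_le hle] at htm
    exact hT.norm_apply_genProcess_le hι₂ hβ hx hη hc₁ hΞ ⟨htm.1.le, lt_of_le_of_ne htm.2 ht⟩
  constructor
  · rw [intervalIntegrable_iff]
    refine Measure.integrableOn_of_bounded (M := c₁ * embNorm ι₂ (genSeq A β η x m ω) + c₂) ?_
      hmeas ?_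
    · simp [Set.uIoc]
    · exact (ae_restrict_iff' measurableSet_uIoc).2 hbound
  · have h := intervalIntegral.norm_integral_le_of_norm_le_const_ae hbound
    have e : arrival β (m + 1) ω - arrival β m ω = β m ω := by
      simp [arrival, Finset.sum_range_succ]
    rwa [e, abs_of_pos (hβ m ω)] at h

/-- The pathwise estimate of the integral between two consecutive extinctions. -/
lemma SemigroupAssumption.integral_between_extinctions (hT : SemigroupAssumption A ι₁ ι₂ κ ρ)
    (hι₁ : Function.Injective ι₁) (hι₂ : Function.Injective ι₂) (hβ : ∀ k ω, 0 < β k ω)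
    (hx₁ : x ω ∈ Set.range ι₁) (hη₁ : ∀ k, η k ω ∈ Set.range ι₁)
    (hx₂ : x ω ∈ Set.range ι₂) (hη₂ : ∀ k, η k ω ∈ Set.range ι₂) (hc₁ : 0 ≤ c₁) (hc₂ : 0 ≤ c₂)
    (hΞ : ∀ v : V₂, ‖Ξ (ι₂ v)‖ ≤ c₁ * ‖v‖ + c₂)
    (hmeas : AEStronglyMeasurable (fun t => Ξ (genProcess A β η x t ω)) volume) {n j : ℕ}
    (hj : extinctionIndex A β η x (n + 1) ω = ((j + 1 : ℕ) : ℕ∞))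
    (hfin : extinctionIndex A β η x (n + 2) ω < ⊤) :
    IntervalIntegrable (fun t => Ξ (genProcess A β η x t ω)) volume
      (extinctionTime A β η x (n + 1) ω) (extinctionTime A β η x (n + 2) ω) ∧
    ∃ L : ℕ, ‖∫ t in (extinctionTime A β η x (n + 1) ω)..(extinctionTime A β η x (n + 2) ω),
        Ξ (genProcess A β η x t ω)‖ ≤
        ∑ l ∈ Finset.range L, β (j + 1 + l) ω *
          ∑ k ∈ Finset.range (l + 1), (c₁ * embNorm ι₂ (η (j + k) ω) + c₂) ∧
      ∀ l < L, κ * ∑ i ∈ Finset.range l, β (j + 1 + i) ω ≤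
        ∑ i ∈ Finset.range l, embNorm ι₁ (η (j + i) ω) ^ ρ := by
  obtain ⟨M, hM⟩ := ENat.ne_top_iff_exists.1 hfin.ne
  obtain ⟨j', hj', h0, -, -⟩ := exists_of_extinctionIndex_succ_eq hj
  obtain rfl : j = j' := by omega
  obtain ⟨p, hp, -, hjp, hne⟩ := exists_of_extinctionIndex_succ_eq hM.symm
  rw [hj] at hjp hne
  have hjp' : j + 1 ≤ p := Nat.cast_le.1 hjp
  obtain ⟨d, rfl⟩ := Nat.exists_eq_add_of_le hjp'
  have e1 : extinctionTime A β η x (n + 1) ω = arrival β (j + 1 + 0) ω := by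
    rw [extinctionTime, hj, ENat.toNat_natCast, add_zero]
  have e2 : extinctionTime A β η x (n + 2) ω = arrival β (j + 1 + (d + 1)) ω := by
    rw [extinctionTime, ← hM, ENat.toNat_natCast, hp]; rfl
  have hpiece := hT.piece_integral hι₂ hβ hx₂ hη₂ hc₁ hΞ hmeas
  have hint : ∀ l < d + 1, IntervalIntegrable (fun t => Ξ (genProcess A β η x t ω)) volume
      (arrival β (j + 1 + l) ω) (arrival β (j + 1 + (l + 1)) ω) := fun l _ =>
    (hpiece (j + 1 + l)).1
  rw [e1, e2]
  -- The next extinction index is j + 1 + d + 1, so the excursion consists of L = d + 1 pieces.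
  refine ⟨IntervalIntegrable.trans_iterate (a := fun l => arrival β (j + 1 + l) ω) hint, d + 1,
    ?_, ?_⟩
  · rw [← intervalIntegral.sum_integral_adjacent_intervals
      (a := fun l => arrival β (j + 1 + l) ω) hint]
    refine (norm_sum_le _ _).trans (Finset.sum_le_sum fun l _ => ?_)
    refine (hpiece (j + 1 + l)).2.trans ?_
    rw [mul_comm]
    refine mul_le_mul_of_nonneg_left ?_ (hβ _ _).le
    have h1 := hT.embNorm_genSeq_le_sum hι₂ hβ hx₂ hη₂ j l h0
    -- The constant c₂ is enlarged to (l + 1)c₂, so that each summand of the inner sum depends on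
    -- one jump only.
    rw [Finset.sum_add_distrib, ← Finset.mul_sum]
    refine add_le_add (mul_le_mul_of_nonneg_left h1 hc₁) ?_
    rw [Finset.sum_const, Finset.card_range, nsmul_eq_mul]
    push_cast
    nlinarith [(Nat.cast_nonneg l : (0 : ℝ) ≤ l)]
  · intro l hl
    refine hT.walk_nonneg hι₁ hβ hx₁ hη₁ j l h0 fun i hi => hne _ ?_ (by omega)
    exact Nat.cast_le.2 (by omega)

end Pathwise

/-! ### Integrals over random intervals. -/

section ParametricIntegral

variable {Ω W : Type*} [MeasurableSpace Ω] [NormedAddCommGroup W] [NormedSpace ℝ W]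

lemma stronglyMeasurable_integral_Ioc {g : ℝ × Ω → W} (hg : StronglyMeasurable g) {a b : Ω → ℝ}
    (ha : Measurable a) (hb : Measurable b) :
    StronglyMeasurable fun ω => ∫ t in Set.Ioc (a ω) (b ω), g (t, ω) := by
  have hS : MeasurableSet {p : Ω × ℝ | p.2 ∈ Set.Ioc (a p.1) (b p.1)} :=
    (measurableSet_lt (ha.comp measurable_fst) measurable_snd).inter
      (measurableSet_le measurable_snd (hb.comp measurable_fst))
  have h := ((hg.comp_measurable measurable_swap).indicator hS).integral_prod_right'
    (ν := (volume : Measure ℝ))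
  convert h using 2 with ω
  rw [← integral_indicator measurableSet_Ioc]
  rfl

end ParametricIntegral

/-! ### Measurability of the process and of the integral between extinctions. -/

section ProcessMeasurability

variable {Ω : Type*} [MeasurableSpace Ω] {β : ℕ → Ω → ℝ}

lemma measurable_arrival (hβ : ∀ k, Measurable (β k)) (m : ℕ) : Measurable (arrival β m) :=
  Finset.measurable_fun_sum _ fun k _ => hβ k

variable {V : Type*} [NormedAddCommGroup V] [NormedSpace ℝ V]
  [CompleteSpace V] [SecondCountableTopology V] [MeasurableSpace V] [BorelSpace V]
  {A : V → Set V} {η : ℕ → Ω → V} {x : Ω → V}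

lemma measurable_genProcess (hA : Accretive A) (hD : DenselyDefined A) (hβ0 : ∀ k ω, 0 < β k ω)
    (hx : Measurable x) (hη : ∀ k, Measurable (η k)) (hβ : ∀ k, Measurable (β k)) :
    Measurable fun p : ℝ × Ω => genProcess A β η x p.1 p.2 := by
  refine measurable_of_tendsto_metrizable (f := fun n (p : ℝ × Ω) => ∑ m ∈ Finset.range n,
    (Set.Ico (arrival β m p.2) (arrival β (m + 1) p.2)).indicator
      (fun s => semigroup A (max (s - arrival β m p.2) 0) (genSeq A β η x m p.2)) p.1) ?_ ?_
  · intro n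
    refine Finset.measurable_fun_sum _ fun m _ => ?_
    have ha : Measurable fun p : ℝ × Ω => arrival β m p.2 :=
      (measurable_arrival hβ m).comp measurable_snd
    have ha' : Measurable fun p : ℝ × Ω => arrival β (m + 1) p.2 :=
      (measurable_arrival hβ (m + 1)).comp measurable_snd
    have hX : Measurable fun p : ℝ × Ω => genSeq A β η x m p.2 :=
      (measurable_genSeq hA hD hβ0 hx m (fun i _ => hη i) (fun i _ => hβ i)).comp measurable_snd
    have hS : MeasurableSet {p : ℝ × Ω | p.1 ∈ Set.Ico (arrival β m p.2) (arrival β (m + 1) p.2)} :=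
      (measurableSet_le ha measurable_fst).inter (measurableSet_lt measurable_fst ha')
    exact ((measurable_semigroup hA hD).comp ((measurable_fst.sub ha).prodMk hX)).indicator hS
  · rw [tendsto_pi_nhds]
    intro p
    exact (hasSum_genProcess hβ0 p.1).tendsto_sum_nat

lemma measurable_extinctionTime (hA : Accretive A) (hD : DenselyDefined A)
    (hβ0 : ∀ k ω, 0 < β k ω) (hx : Measurable x) (hη : ∀ k, Measurable (η k))
    (hβ : ∀ k, Measurable (β k)) (n : ℕ) : Measurable (extinctionTime A β η x n) := by
  have h1 : Measurable (extinctionIndex A β η x n) :=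
    ENat.measurable_iff.2 fun j => measurableSet_extinctionIndex_eq hA hD hβ0 hx n j
      (fun i _ => hη i) (fun i _ => hβ i)
  have h2 : Measurable fun p : ℕ × Ω => arrival β p.1 p.2 :=
    measurable_from_prod_countable_right fun m => measurable_arrival hβ m
  exact h2.comp (((Measurable.of_discrete (f := ENat.toNat)).comp h1).prodMk measurable_id)

variable {W : Type*} [NormedAddCommGroup W] [NormedSpace ℝ W] [SecondCountableTopology W]
  [MeasurableSpace W] [BorelSpace W] {Ξ : V → W}

lemma stronglyMeasurable_intervalIntegral_genProcess (hA : Accretive A) (hD : DenselyDefined A)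
    (hβ0 : ∀ k ω, 0 < β k ω) (hx : Measurable x) (hη : ∀ k, Measurable (η k))
    (hβ : ∀ k, Measurable (β k)) (hΞ : Measurable Ξ) (n m : ℕ) :
    StronglyMeasurable fun ω => ∫ τ in (extinctionTime A β η x n ω)..(extinctionTime A β η x m ω),
      Ξ (genProcess A β η x τ ω) := by
  have hg := (hΞ.comp (measurable_genProcess hA hD hβ0 hx hη hβ)).stronglyMeasurable
  have hn := measurable_extinctionTime hA hD hβ0 hx hη hβ n
  have hm := measurable_extinctionTime hA hD hβ0 hx hη hβ m
  simp only [intervalIntegral]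
  exact (stronglyMeasurable_integral_Ioc hg hn hm).sub (stronglyMeasurable_integral_Ioc hg hm hn)

end ProcessMeasurability

/-! ### Moment bounds and drift of the random walk. -/

section NoiseMoments

/-- Pointwise Markov bounds. The deviations a and c will be independent of h and keep the full power
10. The deviation b will not be, so only the fifth power is used and (1+b)⁵h² is split as (1+b)¹⁰ +
h⁴. -/
lemma indicator_tail_le {E : Prop} [Decidable E] {l a b c h : ℝ} (hl : 0 ≤ l) (ha : 0 ≤ a)
    (hb : 0 ≤ b) (hc : 0 ≤ c) (hE : E → l ≤ a ∨ l ≤ b ∨ l ≤ c) :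
    (if E then h ^ 2 else 0) ≤ ((l + 1) ^ 10)⁻¹ * ((1 + a) ^ 10 * h ^ 2) +
      ((l + 1) ^ 10)⁻¹ * ((1 + c) ^ 10 * h ^ 2) + ((l + 1) ^ 5)⁻¹ * ((1 + b) ^ 10 + h ^ 4) := by
  have hA : 0 ≤ ((l + 1) ^ 10)⁻¹ * ((1 + a) ^ 10 * h ^ 2) := by positivity
  have hC : 0 ≤ ((l + 1) ^ 10)⁻¹ * ((1 + c) ^ 10 * h ^ 2) := by positivity
  have hB : 0 ≤ ((l + 1) ^ 5)⁻¹ * ((1 + b) ^ 10 + h ^ 4) := by positivity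
  split_ifs with hE'
  · have key : ∀ s, l ≤ s → h ^ 2 ≤ ((l + 1) ^ 10)⁻¹ * ((1 + s) ^ 10 * h ^ 2) := by
      intro s hs
      rw [← mul_assoc]
      refine le_mul_of_one_le_left (sq_nonneg h) ?_
      rw [inv_mul_eq_div, one_le_div (by positivity)]
      exact pow_le_pow_left₀ (by linarith) (by linarith) 10
    rcases hE hE' with h1 | h1 | h1
    · linarith [key a h1]
    · have h2 : h ^ 2 ≤ ((l + 1) ^ 5)⁻¹ * ((1 + b) ^ 10 + h ^ 4) := by
        rw [inv_mul_eq_div, le_div_iff₀ (by positivity)]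
        have h3 : (l + 1) ^ 5 ≤ (1 + b) ^ 5 := pow_le_pow_left₀ (by linarith) (by linarith) 5
        have h4 := mul_le_mul_of_nonneg_left h3 (sq_nonneg h)
        nlinarith [sq_nonneg (h ^ 2 - (1 + b) ^ 5), sq_nonneg (h ^ 2), sq_nonneg ((1 + b) ^ 5)]
      linarith
    · linarith [key c h1]
  · linarith

variable {V V₁ V₂ Ω : Type*} [NormedAddCommGroup V] [NormedSpace ℝ V]
  [MeasurableSpace V] [NormedAddCommGroup V₁] [NormedSpace ℝ V₁]
  [NormedAddCommGroup V₂] [NormedSpace ℝ V₂]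
  [MeasurableSpace Ω] {P : Measure Ω} [IsProbabilityMeasure P]
  {ι₁ : V₁ →L[ℝ] V} {ι₂ : V₂ →L[ℝ] V} {κ ρ ε : ℝ} {β : ℕ → Ω → ℝ} {η : ℕ → Ω → V} {x : Ω → V}

lemma memLp_ten_of_integrable_rpow {f : Ω → ℝ} (hf : Measurable f) (hf0 : ∀ ω, 0 ≤ f ω)
    (hε : 0 < ε) (h : Integrable (fun ω => f ω ^ (11 + ε)) P) : MemLp f (10 : ℕ) P := by
  have hp : (0 : ℝ) < 11 + ε := by linarith
  have h1 : MemLp f (ENNReal.ofReal (11 + ε)) P := by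
    rw [← integrable_norm_rpow_iff hf.aestronglyMeasurable (by simpa using hp) (by simp),
      ENNReal.toReal_ofReal hp.le]
    simpa only [fun ω => Real.norm_of_nonneg (hf0 ω)] using h
  refine h1.mono_exponent ?_
  rw [← ENNReal.ofReal_natCast]
  exact ENNReal.ofReal_le_ofReal (by push_cast; linarith)

lemma NoiseAssumption.memLp_beta (hN : NoiseAssumption P ι₁ ι₂ κ ρ ε β η) (k : ℕ) :
    MemLp (β k) (10 : ℕ) P :=
  memLp_ten_of_integrable_rpow (hN.measurable_beta k) (fun ω => (hN.beta_pos k ω).le) hN.eps_pos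
    (hN.moment_beta k)

variable [BorelSpace V] [CompleteSpace V₁] [TopologicalSpace.SeparableSpace V₁]

lemma measurable_embNorm_rpow (hι₁ : Function.Injective ι₁) (ρ : ℝ) :
    Measurable fun u => embNorm ι₁ u ^ ρ := (measurable_embNorm hι₁).pow_const ρ

lemma NoiseAssumption.memLp_eta (hN : NoiseAssumption P ι₁ ι₂ κ ρ ε β η)
    (hι₁ : Function.Injective ι₁) (k : ℕ) :
    MemLp (fun ω => embNorm ι₁ (η k ω) ^ ρ) (10 : ℕ) P := by
  refine memLp_ten_of_integrable_rpow ((measurable_embNorm_rpow hι₁ ρ).comp (hN.measurable_eta k))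
    (fun ω => Real.rpow_nonneg (embNorm_nonneg _) _) hN.eps_pos ?_
  simpa only [fun ω => Real.rpow_mul (embNorm_nonneg (ι := ι₁) (η k ω)) ρ (11 + ε)] using
    hN.moment_eta₁ k

/-- Two strong laws show that the walk divided by n tends to the drift, which is negative. -/
lemma NoiseAssumption.tendsto_walk (hN : NoiseAssumption P ι₁ ι₂ κ ρ ε β η)
    (hι₁ : Function.Injective ι₁) :
    ∀ᵐ ω ∂P, Filter.Tendsto (fun n => ∑ i ∈ Finset.range n,
      (embNorm ι₁ (η i ω) ^ ρ - κ * β i ω)) Filter.atTop Filter.atBot := by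
  have hφ := measurable_embNorm_rpow hι₁ ρ
  have h1 := strong_law_ae_real β
    (by simpa using MemLp.integrable_pow_of_le (hN.memLp_beta 0) (k := 1) (by norm_num))
    (fun i j hij => hN.indep_beta.indepFun hij) (fun i => hN.ident_beta i 0)
  have h2 := strong_law_ae_real (fun k ω => embNorm ι₁ (η k ω) ^ ρ)
    (by simpa using MemLp.integrable_pow_of_le (hN.memLp_eta hι₁ 0) (k := 1) (by norm_num))
    (fun i j hij => (hN.indep_eta.indepFun hij).comp hφ hφ)
    (fun i => (hN.ident_eta i 0).comp hφ)
  filter_upwards [h1, h2] with ω h1 h2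
  have h3 := h2.sub (h1.const_mul κ)
  have hneg : ∫ ω, embNorm ι₁ (η 0 ω) ^ ρ ∂P - κ * ∫ ω, β 0 ω ∂P < 0 := by
    have := hN.drift 0; linarith
  have h4 := Filter.Tendsto.neg_mul_atTop hneg h3 tendsto_natCast_atTop_atTop
  refine h4.congr' ?_
  filter_upwards [Filter.eventually_gt_atTop 0] with n hn
  have hn' : (n : ℝ) ≠ 0 := by exact_mod_cast hn.ne'
  rw [Finset.sum_sub_distrib, ← Finset.mul_sum]
  field_simp

lemma NoiseAssumption.exists_walk_moments (hN : NoiseAssumption P ι₁ ι₂ κ ρ ε β η)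
    (hι₁ : Function.Injective ι₁) {c : ℝ} (hc : 0 < c) :
    ∃ C : ℝ, 0 ≤ C ∧ ∀ (l : ℕ) (I : Finset ℕ), I.card ≤ l →
      ∫⁻ ω, ENNReal.ofReal ((1 + |∑ i ∈ I, (embNorm ι₁ (η i ω) ^ ρ -
        ∫ ω, embNorm ι₁ (η 0 ω) ^ ρ ∂P)| / c) ^ 10) ∂P ≤ ENNReal.ofReal (C * (l + 1) ^ 5) ∧
      ∫⁻ ω, ENNReal.ofReal ((1 + |∑ i ∈ I, (κ * ∫ ω, β 0 ω ∂P - κ * β i ω)| / c) ^ 10) ∂P ≤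
        ENNReal.ofReal (C * (l + 1) ^ 5) := by
  have hφ := measurable_embNorm_rpow hι₁ ρ
  set z := ∫ ω, embNorm ι₁ (η 0 ω) ^ ρ ∂P with hz
  set b := ∫ ω, β 0 ω ∂P with hb
  have hid : ∀ i, IdentDistrib (fun ω => embNorm ι₁ (η i ω) ^ ρ)
      (fun ω => embNorm ι₁ (η 0 ω) ^ ρ) P P := fun i => (hN.ident_eta i 0).comp hφ
  have hψ : Measurable fun s : ℝ => (s - z) ^ 10 := by fun_prop
  have hψ' : Measurable fun s : ℝ => (κ * b - κ * s) ^ 10 := by fun_prop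
  obtain ⟨C₁, hC₁, h₁⟩ := exists_lintegral_one_add_pow_le
    (Y := fun i ω => embNorm ι₁ (η i ω) ^ ρ - z) (K := ∫ ω, (embNorm ι₁ (η 0 ω) ^ ρ - z) ^ 10 ∂P)
    (fun i => (hN.memLp_eta hι₁ i).sub (memLp_const z))
    (fun i => (hφ.comp (hN.measurable_eta i)).sub_const z)
    (hN.indep_eta.comp (fun _ u => embNorm ι₁ u ^ ρ - z) fun _ => hφ.sub_const z)
    (fun i => by
      have := MemLp.integrable_pow_of_le (hN.memLp_eta hι₁ i) (k := 1) (by norm_num)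
      simp only [pow_one] at this
      rw [integral_sub this (integrable_const z), (hid i).integral_eq]
      simp [hz])
    (fun i => ((hid i).comp hψ).integral_eq.le) hc
  obtain ⟨C₂, hC₂, h₂⟩ := exists_lintegral_one_add_pow_le
    (Y := fun i ω => κ * b - κ * β i ω) (K := ∫ ω, (κ * b - κ * β 0 ω) ^ 10 ∂P)
    (fun i => (memLp_const (κ * b)).sub ((hN.memLp_beta i).const_mul κ))
    (fun i => ((hN.measurable_beta i).const_mul κ).const_sub (κ * b))
    (hN.indep_beta.comp (fun _ s => κ * b - κ * s) fun _ => by fun_prop)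
    (fun i => by
      have := MemLp.integrable_pow_of_le (hN.memLp_beta i) (k := 1) (by norm_num)
      simp only [pow_one] at this
      rw [integral_sub (integrable_const _) (this.const_mul κ), integral_const_mul κ (β i),
        (hN.ident_beta i 0).integral_eq]
      simp [hb])
    (fun i => ((hN.ident_beta i 0).comp hψ').integral_eq.le) hc
  refine ⟨max C₁ C₂, le_max_of_le_left hC₁, fun l I hI => ⟨(h₁ l I hI).trans ?_,
    (h₂ l I hI).trans ?_⟩⟩
  · exact ENNReal.ofReal_le_ofReal (mul_le_mul_of_nonneg_right (le_max_left _ _) (by positivity))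
  · exact ENNReal.ofReal_le_ofReal (mul_le_mul_of_nonneg_right (le_max_right _ _) (by positivity))

end NoiseMoments

/-! ### Tail estimate for the event that the walk has stayed nonnegative. -/

section SquareIntegrability

/-- The event that the random walk started at index `j` is nonnegative after `l` steps. -/
def walkEvent {V V₁ Ω : Type*} [NormedAddCommGroup V₁] (ι₁ : V₁ → V) (κ ρ : ℝ) (β : ℕ → Ω → ℝ)
    (η : ℕ → Ω → V) (j l : ℕ) : Set Ω :=
  {ω | κ * ∑ i ∈ Finset.range l, β (j + 1 + i) ω ≤
    ∑ i ∈ Finset.range l, embNorm ι₁ (η (j + i) ω) ^ ρ}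

lemma lintegral_indicator_tail_le {Ω : Type*} [MeasurableSpace Ω] {P : Measure Ω} {E : Set Ω}
    {U B D h : Ω → ℝ} {l K K' H : ℝ} (hl : 0 ≤ l) (mU : Measurable U) (mB : Measurable B)
    (mD : Measurable D) (mh : Measurable h) (hU : ∀ ω, 0 ≤ U ω) (hB : ∀ ω, 0 ≤ B ω)
    (hD : ∀ ω, 0 ≤ D ω) (hE : ∀ ω ∈ E, l ≤ U ω ∨ l ≤ B ω ∨ l ≤ D ω) (hK : 0 ≤ K) (hH : 0 ≤ H)
    (hK' : 0 ≤ K')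
    (bU : ∫⁻ ω, ENNReal.ofReal ((1 + U ω) ^ 10) * ENNReal.ofReal (h ω ^ 2) ∂P ≤
      ENNReal.ofReal (K * (l + 1) ^ 5) * ENNReal.ofReal H)
    (bD : ∫⁻ ω, ENNReal.ofReal ((1 + D ω) ^ 10) * ENNReal.ofReal (h ω ^ 2) ∂P ≤
      ENNReal.ofReal (K * (l + 1) ^ 5) * ENNReal.ofReal H)
    (bB : ∫⁻ ω, ENNReal.ofReal ((1 + B ω) ^ 10) ∂P ≤ ENNReal.ofReal K')
    (bh : ∫⁻ ω, ENNReal.ofReal (h ω ^ 4) ∂P ≤ ENNReal.ofReal H) :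
    ∫⁻ ω, E.indicator (fun ω => ENNReal.ofReal (h ω ^ 2)) ω ∂P ≤
      ENNReal.ofReal ((2 * (K * H) + (K' + H)) * ((l + 1) ^ 5)⁻¹) := by
  classical
  set q := ENNReal.ofReal (((l + 1) ^ 10)⁻¹) with hq
  set r := ENNReal.ofReal (((l + 1) ^ 5)⁻¹) with hr
  have hpt : ∀ ω, E.indicator (fun ω => ENNReal.ofReal (h ω ^ 2)) ω ≤
      q * (ENNReal.ofReal ((1 + U ω) ^ 10) * ENNReal.ofReal (h ω ^ 2)) +
      q * (ENNReal.ofReal ((1 + D ω) ^ 10) * ENNReal.ofReal (h ω ^ 2)) +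
      r * (ENNReal.ofReal ((1 + B ω) ^ 10) + ENNReal.ofReal (h ω ^ 4)) := by
    intro ω
    have hUω := hU ω
    have hBω := hB ω
    have hDω := hD ω
    have h1 := indicator_tail_le (E := ω ∈ E) (h := h ω) hl hUω hBω hDω (hE ω)
    have h2 : E.indicator (fun ω => ENNReal.ofReal (h ω ^ 2)) ω =
        ENNReal.ofReal (if ω ∈ E then h ω ^ 2 else 0) := by
      by_cases hω : ω ∈ E <;> simp [hω]
    rw [h2]
    refine (ENNReal.ofReal_le_ofReal h1).trans (le_of_eq ?_)
    rw [ENNReal.ofReal_add (by positivity) (by positivity),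
      ENNReal.ofReal_add (by positivity) (by positivity),
      ENNReal.ofReal_mul (by positivity), ENNReal.ofReal_mul (by positivity),
      ENNReal.ofReal_mul (by positivity), ENNReal.ofReal_mul (by positivity),
      ENNReal.ofReal_mul (by positivity), ENNReal.ofReal_add (by positivity) (by positivity)]
  have m1 : Measurable fun ω => ENNReal.ofReal ((1 + U ω) ^ 10) * ENNReal.ofReal (h ω ^ 2) :=
    ((mU.const_add 1).pow_const 10).ennreal_ofReal.mul (mh.pow_const 2).ennreal_ofReal
  have m2 : Measurable fun ω => ENNReal.ofReal ((1 + D ω) ^ 10) * ENNReal.ofReal (h ω ^ 2) :=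
    ((mD.const_add 1).pow_const 10).ennreal_ofReal.mul (mh.pow_const 2).ennreal_ofReal
  have m3 : Measurable fun ω => ENNReal.ofReal ((1 + B ω) ^ 10) :=
    ((mB.const_add 1).pow_const 10).ennreal_ofReal
  have m4 : Measurable fun ω => ENNReal.ofReal (h ω ^ 4) := (mh.pow_const 4).ennreal_ofReal
  refine (lintegral_mono hpt).trans ?_
  have m12 : Measurable fun ω => q * (ENNReal.ofReal ((1 + U ω) ^ 10) * ENNReal.ofReal (h ω ^ 2)) +
      q * (ENNReal.ofReal ((1 + D ω) ^ 10) * ENNReal.ofReal (h ω ^ 2)) :=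
    (m1.const_mul q).add (m2.const_mul q)
  rw [lintegral_add_left m12,
    lintegral_add_left (m1.const_mul q), lintegral_const_mul q m1, lintegral_const_mul q m2,
    lintegral_const_mul r (m3.add m4 : Measurable fun ω => _ + _), lintegral_add_left m3]
  have hfin := add_le_add (add_le_add (mul_le_mul' (le_refl q) bU)
    (mul_le_mul' (le_refl q) bD)) (mul_le_mul' (le_refl r) (add_le_add bB bh))
  refine hfin.trans (le_of_eq ?_)
  rw [hq, hr, ← ENNReal.ofReal_mul (by positivity), ← ENNReal.ofReal_mul (by positivity),
    ← ENNReal.ofReal_add (by positivity) (by positivity),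
    ← ENNReal.ofReal_add (by positivity) (by positivity), ← ENNReal.ofReal_mul (by positivity),
    ← ENNReal.ofReal_add (by positivity) (by positivity)]
  congr 1
  have : l + 1 ≠ 0 := by positivity
  field_simp
  ring

variable {V V₁ V₂ Ω : Type*} [NormedAddCommGroup V] [NormedSpace ℝ V]
  [NormedAddCommGroup V₁] [NormedSpace ℝ V₁]
  {ι₁ : V₁ →L[ℝ] V} {κ ρ ε : ℝ} {β : ℕ → Ω → ℝ} {η : ℕ → Ω → V} {x : Ω → V} {c₁ c₂ : ℝ}

/-- On this event the centred sums exceed l times the drift gap κb - z, that is 3lc, so one of the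
three pieces is at least lc. Isolating the k-th jump makes the other two pieces independent of it.
-/
lemma walkEvent_cases {z b : ℝ} {j l k : ℕ} {ω : Ω} (hω : ω ∈ walkEvent ι₁ κ ρ β η j l)
    (hd : 0 < (κ * b - z) / 3) :
    let c := (κ * b - z) / 3
    (l : ℝ) ≤ |∑ i ∈ (Finset.Ico j (j + l)).erase k, (embNorm ι₁ (η i ω) ^ ρ - z)| / c ∨
    (l : ℝ) ≤ |∑ i ∈ ({k} : Finset ℕ), (embNorm ι₁ (η i ω) ^ ρ - z)| / c ∨
    (l : ℝ) ≤ |∑ i ∈ Finset.Ico (j + 1) (j + 1 + l), (κ * b - κ * β i ω)| / c := by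
  intro c
  rw [le_div_iff₀ hd, le_div_iff₀ hd, le_div_iff₀ hd, Finset.sum_singleton]
  have h1 : κ * ∑ i ∈ Finset.Ico (j + 1) (j + 1 + l), β i ω ≤
      ∑ i ∈ Finset.Ico j (j + l), embNorm ι₁ (η i ω) ^ ρ := by
    rw [Finset.sum_Ico_eq_sum_range, Finset.sum_Ico_eq_sum_range, Nat.add_sub_cancel_left,
      Nat.add_sub_cancel_left]
    exact hω
  have h2 : ∑ i ∈ Finset.Ico j (j + l), (embNorm ι₁ (η i ω) ^ ρ - z) =
      ∑ i ∈ Finset.Ico j (j + l), embNorm ι₁ (η i ω) ^ ρ - l * z := by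
    rw [Finset.sum_sub_distrib, Finset.sum_const, Nat.card_Ico, Nat.add_sub_cancel_left,
      nsmul_eq_mul]
  have h3 : ∑ i ∈ Finset.Ico (j + 1) (j + 1 + l), (κ * b - κ * β i ω) =
      l * (κ * b) - κ * ∑ i ∈ Finset.Ico (j + 1) (j + 1 + l), β i ω := by
    rw [Finset.sum_sub_distrib, Finset.sum_const, Nat.card_Ico, Nat.add_sub_cancel_left,
      nsmul_eq_mul, ← Finset.mul_sum]
  have h4 : ∑ i ∈ Finset.Ico j (j + l), (embNorm ι₁ (η i ω) ^ ρ - z) ≤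
      ∑ i ∈ (Finset.Ico j (j + l)).erase k, (embNorm ι₁ (η i ω) ^ ρ - z) +
        |embNorm ι₁ (η k ω) ^ ρ - z| := by
    by_cases hk : k ∈ Finset.Ico j (j + l)
    · rw [← Finset.sum_erase_add _ _ hk]
      exact add_le_add le_rfl (le_abs_self _)
    · rw [Finset.erase_eq_of_notMem hk]
      linarith [abs_nonneg (embNorm ι₁ (η k ω) ^ ρ - z)]
  by_contra! hcon
  obtain ⟨g1, g2, g3⟩ := hcon
  have g4 := le_abs_self (∑ i ∈ (Finset.Ico j (j + l)).erase k, (embNorm ι₁ (η i ω) ^ ρ - z))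
  have g5 := le_abs_self (∑ i ∈ Finset.Ico (j + 1) (j + 1 + l), (κ * b - κ * β i ω))
  have g6 : (l : ℝ) * (κ * b) - l * z = 3 * (l * c) := by simp only [c]; ring
  linarith

variable [NormedAddCommGroup V₂] [NormedSpace ℝ V₂] [CompleteSpace V₂]
  [TopologicalSpace.SeparableSpace V₂] [MeasurableSpace V] [BorelSpace V]
  {mΩ : MeasurableSpace Ω} {P : Measure Ω} [IsProbabilityMeasure P] {ι₂ : V₂ →L[ℝ] V}

lemma NoiseAssumption.exists_moment_bound (hN : NoiseAssumption P ι₁ ι₂ κ ρ ε β η)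
    (hι₂ : Function.Injective ι₂) (hc₁ : 0 ≤ c₁) (hc₂ : 0 ≤ c₂) :
    ∃ H : ℝ, 0 ≤ H ∧ ∀ k,
      ∫⁻ ω, ENNReal.ofReal ((c₁ * embNorm ι₂ (η k ω) + c₂) ^ 2) ∂P ≤ ENNReal.ofReal H ∧
      ∫⁻ ω, ENNReal.ofReal ((c₁ * embNorm ι₂ (η k ω) + c₂) ^ 4) ∂P ≤ ENNReal.ofReal H := by
  have hφ : Measurable fun u => 1 + 2 ^ 3 * (c₁ ^ 4 * embNorm ι₂ u ^ 4 + c₂ ^ 4) :=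
    ((((measurable_embNorm hι₂).pow_const 4).const_mul _).add_const _).const_mul _ |>.const_add _
  have hint : ∀ k, Integrable (fun ω => 1 + 2 ^ 3 * (c₁ ^ 4 * embNorm ι₂ (η k ω) ^ 4 + c₂ ^ 4)) P :=
    fun k => (integrable_const _).add
      ((((hN.moment_eta₂ k).const_mul _).add (integrable_const _)).const_mul _)
  have hpos : ∀ u, 0 ≤ 1 + 2 ^ 3 * (c₁ ^ 4 * embNorm ι₂ u ^ 4 + c₂ ^ 4) := fun u => by
    have := embNorm_nonneg (ι := ι₂) u
    positivity
  have h4 : ∀ u, (c₁ * embNorm ι₂ u + c₂) ^ 4 ≤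
      1 + 2 ^ 3 * (c₁ ^ 4 * embNorm ι₂ u ^ 4 + c₂ ^ 4) := fun u => by
    have := add_pow_le (mul_nonneg hc₁ (embNorm_nonneg (ι := ι₂) u)) hc₂ 4
    rw [mul_pow] at this
    norm_num only at this ⊢
    linarith
  have h2 : ∀ u, (c₁ * embNorm ι₂ u + c₂) ^ 2 ≤
      1 + 2 ^ 3 * (c₁ ^ 4 * embNorm ι₂ u ^ 4 + c₂ ^ 4) := fun u => by
    have h := add_pow_le (mul_nonneg hc₁ (embNorm_nonneg (ι := ι₂) u)) hc₂ 4
    rw [mul_pow] at h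
    norm_num only at h ⊢
    nlinarith [sq_nonneg ((c₁ * embNorm ι₂ u + c₂) ^ 2 - 1)]
  refine ⟨∫ ω, (1 + 2 ^ 3 * (c₁ ^ 4 * embNorm ι₂ (η 0 ω) ^ 4 + c₂ ^ 4)) ∂P,
    integral_nonneg fun ω => hpos _, fun k => ?_⟩
  have e : ∫⁻ ω, ENNReal.ofReal (1 + 2 ^ 3 * (c₁ ^ 4 * embNorm ι₂ (η k ω) ^ 4 + c₂ ^ 4)) ∂P =
      ENNReal.ofReal (∫ ω, (1 + 2 ^ 3 * (c₁ ^ 4 * embNorm ι₂ (η 0 ω) ^ 4 + c₂ ^ 4)) ∂P) := by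
    have hid := ((hN.ident_eta k 0).comp hφ).integral_eq
    simp only [Function.comp_def] at hid
    rw [← hid, ofReal_integral_eq_lintegral_ofReal (hint k)
      (Filter.Eventually.of_forall fun ω => hpos _)]
  rw [← e]
  exact ⟨lintegral_mono fun ω => ENNReal.ofReal_le_ofReal (h2 _),
    lintegral_mono fun ω => ENNReal.ofReal_le_ofReal (h4 _)⟩

variable [CompleteSpace V₁] [TopologicalSpace.SeparableSpace V₁]

lemma NoiseAssumption.exists_tail_moment (hN : NoiseAssumption P ι₁ ι₂ κ ρ ε β η)
    (hx : IndependentInitial P ι₁ ι₂ ρ β η x) (hι₁ : Function.Injective ι₁)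
    (hι₂ : Function.Injective ι₂) (hc₁ : 0 ≤ c₁) (hc₂ : 0 ≤ c₂) :
    ∃ C : ℝ, 0 ≤ C ∧ ∀ j l k : ℕ, ∫⁻ ω, (walkEvent ι₁ κ ρ β η j l).indicator
      (fun ω => ENNReal.ofReal ((c₁ * embNorm ι₂ (η k ω) + c₂) ^ 2)) ω ∂P ≤
        ENNReal.ofReal (C * ((l + 1 : ℝ) ^ 5)⁻¹) := by
  classical
  set z := ∫ ω, embNorm ι₁ (η 0 ω) ^ ρ ∂P with hz
  set b := ∫ ω, β 0 ω ∂P with hb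
  have hd : 0 < (κ * b - z) / 3 := by
    have := hN.drift 0; linarith
  set c := (κ * b - z) / 3 with hc
  obtain ⟨H, hH, hmom⟩ := hN.exists_moment_bound hι₂ hc₁ hc₂
  obtain ⟨K, hK, hwalk⟩ := hN.exists_walk_moments hι₁ hd
  -- The term 2KH comes from the two pieces independent of h. The factor 2⁵ is (l+1)⁵ at l = 1,
  -- because the third piece is a sum over one index.
  refine ⟨2 * (K * H) + (K * 2 ^ 5 + H), by positivity, fun j l k => ?_⟩
  set h : Ω → ℝ := fun ω => c₁ * embNorm ι₂ (η k ω) + c₂ with hh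
  set U : Ω → ℝ := fun ω =>
    |∑ i ∈ (Finset.Ico j (j + l)).erase k, (embNorm ι₁ (η i ω) ^ ρ - z)| / c with hU
  set B : Ω → ℝ := fun ω => |∑ i ∈ ({k} : Finset ℕ), (embNorm ι₁ (η i ω) ^ ρ - z)| / c with hB
  set D : Ω → ℝ := fun ω =>
    |∑ i ∈ Finset.Ico (j + 1) (j + 1 + l), (κ * b - κ * β i ω)| / c with hD
  have hφ := measurable_embNorm_rpow hι₁ ρ
  have hle := noiseAlgebra_le hx.measurable hN.measurable_eta hN.measurable_beta
  have hind := iIndep_noiseAlgebra hN.indep_beta hN.indep_eta hN.indep_eta_beta hx.indep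
  -- Here h lives on the index of η_k and U, D on the complement; B shares η_k with h and is
  -- therefore not factored.
  set S : Set (Unit ⊕ (ℕ ⊕ ℕ)) := {Sum.inr (Sum.inl k)} with hS
  have hdisj : Disjoint Sᶜ S := disjoint_compl_left
  have mh : Measurable[⨆ i ∈ S, noiseAlgebra x η β i] h :=
    (((measurable_embNorm hι₂).comp
      (measurable_noise_eta (k := k) (Set.mem_singleton _))).const_mul c₁).add_const c₂
  have mU : Measurable[⨆ i ∈ Sᶜ, noiseAlgebra x η β i] U := by
    refine Measurable.div_const (continuous_abs.measurable.comp
      (Finset.measurable_fun_sum _ fun i hi => ?_)) c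
    refine (hφ.comp (measurable_noise_eta ?_)).sub_const z
    simpa [hS] using Finset.ne_of_mem_erase hi
  have mD : Measurable[⨆ i ∈ Sᶜ, noiseAlgebra x η β i] D := by
    refine Measurable.div_const (continuous_abs.measurable.comp
      (Finset.measurable_fun_sum _ fun i hi => ?_)) c
    refine ((measurable_noise_beta ?_).const_mul κ).const_sub _
    simp [hS]
  have leS : (⨆ i ∈ S, noiseAlgebra x η β i) ≤ mΩ := iSup₂_le fun i _ => hle i
  have leSc : (⨆ i ∈ Sᶜ, noiseAlgebra x η β i) ≤ mΩ := iSup₂_le fun i _ => hle i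
  have mh' : Measurable h := mh.mono leS le_rfl
  have mU' : Measurable U := mU.mono leSc le_rfl
  have mD' : Measurable D := mD.mono leSc le_rfl
  have mB' : Measurable B := Measurable.div_const (Measurable.abs
    (Finset.measurable_fun_sum _ fun i _ => (hφ.comp (hN.measurable_eta i)).sub_const z)) c
  have hcard : ((Finset.Ico j (j + l)).erase k).card ≤ l :=
    (Finset.card_erase_le).trans (by simp)
  have bU := (hwalk l _ hcard).1
  have bD := (hwalk l (Finset.Ico (j + 1) (j + 1 + l)) (by simp)).2
  have bB := (hwalk 1 {k} (by simp)).1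
  have prodU : ∫⁻ ω, ENNReal.ofReal ((1 + U ω) ^ 10) * ENNReal.ofReal (h ω ^ 2) ∂P ≤
      ENNReal.ofReal (K * (l + 1) ^ 5) * ENNReal.ofReal H := by
    rw [lintegral_mul_of_iIndep hle hind hdisj ((mU.const_add 1).pow_const 10).ennreal_ofReal
      (mh.pow_const 2).ennreal_ofReal]
    exact mul_le_mul' bU (hmom k).1
  have prodD : ∫⁻ ω, ENNReal.ofReal ((1 + D ω) ^ 10) * ENNReal.ofReal (h ω ^ 2) ∂P ≤
      ENNReal.ofReal (K * (l + 1) ^ 5) * ENNReal.ofReal H := by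
    rw [lintegral_mul_of_iIndep hle hind hdisj ((mD.const_add 1).pow_const 10).ennreal_ofReal
      (mh.pow_const 2).ennreal_ofReal]
    exact mul_le_mul' bD (hmom k).1
  have hfin := lintegral_indicator_tail_le (E := walkEvent ι₁ κ ρ β η j l) (Nat.cast_nonneg l)
    mU' mB' mD' mh' (fun ω => by positivity) (fun ω => by positivity) (fun ω => by positivity)
    (fun ω hω => walkEvent_cases hω hd) hK hH (by positivity) prodU prodD bB (hmom k).2
  refine hfin.trans (ENNReal.ofReal_le_ofReal (le_of_eq ?_))
  norm_num

end SquareIntegrability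

/-! ### Weighted Cauchy–Schwarz. -/

section Weights

/-- The weight `(l + 1)^{3/2}`. -/
def weight (l : ℕ) : ℝ := (l + 1 : ℝ) ^ (3 / 2 : ℝ)

lemma weight_pos (l : ℕ) : 0 < weight l := Real.rpow_pos_of_pos (by positivity) _

lemma weight_mul_self (l : ℕ) : weight l * weight l = (l + 1 : ℝ) ^ 3 := by
  rw [weight, ← Real.rpow_add (by positivity), ← Real.rpow_natCast]
  norm_num

lemma summable_inv_weight : Summable fun l => (weight l)⁻¹ := by
  have h := (summable_nat_add_iff 1).2
    (Real.summable_one_div_nat_rpow.2 (show (1 : ℝ) < 3 / 2 by norm_num))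
  simpa [weight] using h

/-- Cauchy–Schwarz over l with weights, then over k at the cost of l + 1. The exponent 3/2 balances
the two series: since the squared weight is (l+1)³, the tail (l+1)^{-5} turns weight · (l+1)² back
into the inverse weight. -/
lemma sq_sum_le_weighted (b h : ℕ → ℝ) (L : ℕ) :
    (∑ l ∈ Finset.range L, b l * ∑ k ∈ Finset.range (l + 1), h k) ^ 2 ≤
      (∑' l, (weight l)⁻¹) * ∑ l ∈ Finset.range L, (weight l * (l + 1)) *
        ∑ k ∈ Finset.range (l + 1), b l ^ 2 * h k ^ 2 := by
  have hw : ∀ l, 0 ≤ (weight l)⁻¹ := fun l => (inv_pos.2 (weight_pos l)).le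
  have h1 := Finset.sum_sq_le_sum_mul_sum_of_sq_le_mul (Finset.range L)
    (r := fun l => b l * ∑ k ∈ Finset.range (l + 1), h k) (f := fun l => (weight l)⁻¹)
    (g := fun l => weight l * (b l * ∑ k ∈ Finset.range (l + 1), h k) ^ 2)
    (fun l _ => hw l) (fun l _ => mul_nonneg (weight_pos l).le (sq_nonneg _))
    (fun l _ => by rw [← mul_assoc, inv_mul_cancel₀ (weight_pos l).ne', one_mul])
  refine h1.trans (mul_le_mul (summable_inv_weight.sum_le_tsum _ fun l _ => hw l)
    (Finset.sum_le_sum fun l _ => ?_)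
    (Finset.sum_nonneg fun l _ => mul_nonneg (weight_pos l).le (sq_nonneg _))
    (tsum_nonneg hw))
  rw [mul_assoc]
  refine mul_le_mul_of_nonneg_left ?_ (weight_pos l).le
  have h2 := sq_sum_le_card_mul_sum_sq (s := Finset.range (l + 1)) (f := h)
  rw [Finset.card_range] at h2
  push_cast at h2
  rw [mul_pow, ← Finset.mul_sum]
  calc b l ^ 2 * (∑ k ∈ Finset.range (l + 1), h k) ^ 2
      ≤ b l ^ 2 * ((l + 1) * ∑ k ∈ Finset.range (l + 1), h k ^ 2) :=
        mul_le_mul_of_nonneg_left h2 (sq_nonneg _)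
    _ = _ := by ring

end Weights

/-! ### Expected size of an excursion given the past. -/

section Future

variable {V V₁ V₂ Ω : Type*} [NormedAddCommGroup V] [NormedSpace ℝ V]
  [NormedAddCommGroup V₁] [NormedSpace ℝ V₁] [NormedAddCommGroup V₂] [NormedSpace ℝ V₂]

/-- Dominates the square of the integral between the extinction at index `j + 1` and the next
one, in terms of the noise after that extinction. -/
def futureBound (ι₁ : V₁ →L[ℝ] V) (ι₂ : V₂ →L[ℝ] V) (κ ρ c₁ c₂ : ℝ) (β : ℕ → Ω → ℝ)
    (η : ℕ → Ω → V) (j : ℕ) (ω : Ω) : ENNReal :=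
  ∑' l : ℕ, ENNReal.ofReal (weight l * (l + 1)) * ∑ k ∈ Finset.range (l + 1),
    ENNReal.ofReal (β (j + 1 + l) ω ^ 2) * (walkEvent ι₁ κ ρ β η j l).indicator
      (fun ω => ENNReal.ofReal ((c₁ * embNorm ι₂ (η (j + k) ω) + c₂) ^ 2)) ω

variable {ι₁ : V₁ →L[ℝ] V} {ι₂ : V₂ →L[ℝ] V} {κ ρ ε : ℝ} {β : ℕ → Ω → ℝ} {η : ℕ → Ω → V}
  {x : Ω → V} {c₁ c₂ : ℝ}

/-- The number L of pieces is random. Since ω lies in each event with l < L, the finite sum is part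
of the infinite series with indicators, in which L no longer appears. -/
lemma enorm_sq_le_futureBound {W : Type*} [NormedAddCommGroup W] {y : W} {j L : ℕ} {ω : Ω}
    (hy : ‖y‖ ≤ ∑ l ∈ Finset.range L, β (j + 1 + l) ω *
      ∑ k ∈ Finset.range (l + 1), (c₁ * embNorm ι₂ (η (j + k) ω) + c₂))
    (hE : ∀ l < L, ω ∈ walkEvent ι₁ κ ρ β η j l) :
    ‖y‖ₑ ^ 2 ≤ ENNReal.ofReal (∑' l, (weight l)⁻¹) *
      futureBound ι₁ ι₂ κ ρ c₁ c₂ β η j ω := by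
  have h1 := (pow_le_pow_left₀ (norm_nonneg y) hy 2).trans (sq_sum_le_weighted
    (fun l => β (j + 1 + l) ω) (fun k => c₁ * embNorm ι₂ (η (j + k) ω) + c₂) L)
  have hn : ∀ l ∈ Finset.range L, 0 ≤ weight l * (l + 1) * ∑ k ∈ Finset.range (l + 1),
      β (j + 1 + l) ω ^ 2 * (c₁ * embNorm ι₂ (η (j + k) ω) + c₂) ^ 2 := fun l _ =>
    mul_nonneg (mul_nonneg (weight_pos l).le (by positivity))
      (Finset.sum_nonneg fun k _ => by positivity)
  rw [← ofReal_norm, ← ENNReal.ofReal_pow (norm_nonneg y)]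
  refine (ENNReal.ofReal_le_ofReal h1).trans ?_
  rw [ENNReal.ofReal_mul (tsum_nonneg fun l => (inv_pos.2 (weight_pos l)).le),
    ENNReal.ofReal_sum_of_nonneg hn]
  refine mul_le_mul' le_rfl (le_trans (le_of_eq ?_) (ENNReal.sum_le_tsum (Finset.range L)))
  refine Finset.sum_congr rfl fun l hl => ?_
  rw [ENNReal.ofReal_mul (mul_nonneg (weight_pos l).le (by positivity)),
    ENNReal.ofReal_sum_of_nonneg fun k _ => by positivity]
  congr 1
  refine Finset.sum_congr rfl fun k _ => ?_
  rw [Set.indicator_of_mem (hE l (Finset.mem_range.1 hl)), ENNReal.ofReal_mul (sq_nonneg _)]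

variable [MeasurableSpace V] [BorelSpace V] [CompleteSpace V₁]
  [TopologicalSpace.SeparableSpace V₁]

lemma measurableSet_walkEvent {m : MeasurableSpace Ω} (hι₁ : Function.Injective ι₁) {j l : ℕ}
    (hη : ∀ i < l, Measurable (η (j + i))) (hβ : ∀ i < l, Measurable (β (j + 1 + i))) :
    MeasurableSet (walkEvent ι₁ κ ρ β η j l) := by
  refine measurableSet_le (Measurable.const_mul (Finset.measurable_fun_sum _ fun i hi =>
    hβ i (Finset.mem_range.1 hi)) κ) (Finset.measurable_fun_sum _ fun i hi => ?_)
  exact (measurable_embNorm_rpow hι₁ ρ).comp (hη i (Finset.mem_range.1 hi))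

variable [CompleteSpace V₂] [TopologicalSpace.SeparableSpace V₂]

lemma measurable_walkEvent_indicator {m : MeasurableSpace Ω} (hι₁ : Function.Injective ι₁)
    (hι₂ : Function.Injective ι₂) {j l k : ℕ} (hk : Measurable (η k))
    (hη : ∀ i < l, Measurable (η (j + i))) (hβ : ∀ i < l, Measurable (β (j + 1 + i))) :
    Measurable ((walkEvent ι₁ κ ρ β η j l).indicator
      (fun ω => ENNReal.ofReal ((c₁ * embNorm ι₂ (η k ω) + c₂) ^ 2))) := by
  refine Measurable.indicator ?_ (measurableSet_walkEvent hι₁ hη hβ)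
  exact (((((measurable_embNorm hι₂).comp hk).const_mul c₁).add_const c₂).pow_const
    2).ennreal_ofReal

/-- The indices of the variables that determine whether an extinction happens at index `j + 1`. -/
def pastIndices (j : ℕ) : Set (Unit ⊕ (ℕ ⊕ ℕ)) :=
  {i | match i with
    | Sum.inl _ => True
    | Sum.inr (Sum.inl k) => k < j
    | Sum.inr (Sum.inr k) => k < j + 1}

variable {mΩ : MeasurableSpace Ω} {P : Measure Ω} [IsProbabilityMeasure P]

/-- Independence is used twice: G involves only the past while the bound uses η_i with i ≥ j and β_i
with i > j; then β_{j+1+l} separates from the walk event, whose waiting times stop at j + l. -/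
lemma NoiseAssumption.exists_lintegral_futureBound_le (hN : NoiseAssumption P ι₁ ι₂ κ ρ ε β η)
    (hx : IndependentInitial P ι₁ ι₂ ρ β η x) (hι₁ : Function.Injective ι₁)
    (hι₂ : Function.Injective ι₂) (hc₁ : 0 ≤ c₁) (hc₂ : 0 ≤ c₂) :
    ∃ C : ENNReal, C ≠ ⊤ ∧ ∀ (j : ℕ) (G : Set Ω),
      MeasurableSet[⨆ i ∈ pastIndices j, noiseAlgebra x η β i] G →
      ∫⁻ ω in G, futureBound ι₁ ι₂ κ ρ c₁ c₂ β η j ω ∂P ≤ P G * C := by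
  obtain ⟨C, hC, htail⟩ := hN.exists_tail_moment hx hι₁ hι₂ hc₁ hc₂
  set B := ∫ ω, β 0 ω ^ 2 ∂P with hB
  have hB0 : 0 ≤ B := integral_nonneg fun ω => sq_nonneg _
  have hβ2 : ∀ k, ∫⁻ ω, ENNReal.ofReal (β k ω ^ 2) ∂P = ENNReal.ofReal B := by
    intro k
    have hid := ((hN.ident_beta k 0).comp (measurable_id.pow_const 2)).integral_eq
    simp only [Function.comp_def, id] at hid
    rw [hB, ← hid, ofReal_integral_eq_lintegral_ofReal
      (MemLp.integrable_pow_of_le (hN.memLp_beta k) (by norm_num))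
      (Filter.Eventually.of_forall fun ω => sq_nonneg _)]
  refine ⟨∑' l, ENNReal.ofReal (B * C * (weight l)⁻¹), ?_, fun j G hG => ?_⟩
  · exact (summable_inv_weight.mul_left (B * C)).tsum_ofReal_ne_top
  have hle := noiseAlgebra_le hx.measurable hN.measurable_eta hN.measurable_beta
  have hind := iIndep_noiseAlgebra hN.indep_beta hN.indep_eta hN.indep_eta_beta hx.indep
  have hG' : MeasurableSet G := (iSup₂_le fun i _ => hle i : _ ≤ mΩ) G hG
  have hterm : ∀ l k, ∫⁻ ω in G, (ENNReal.ofReal (β (j + 1 + l) ω ^ 2) *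
      (walkEvent ι₁ κ ρ β η j l).indicator
        (fun ω => ENNReal.ofReal ((c₁ * embNorm ι₂ (η (j + k) ω) + c₂) ^ 2)) ω) ∂P ≤
      P G * (ENNReal.ofReal B * ENNReal.ofReal (C * ((l + 1 : ℝ) ^ 5)⁻¹)) := by
    intro l k
    have e1 : ∀ f : Ω → ENNReal, ∫⁻ ω in G, f ω ∂P = ∫⁻ ω, G.indicator 1 ω * f ω ∂P := by
      intro f
      rw [← lintegral_indicator hG']
      refine lintegral_congr fun ω => ?_
      by_cases hω : ω ∈ G <;> simp [hω]
    have mG : Measurable[⨆ i ∈ pastIndices j, noiseAlgebra x η β i]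
        (G.indicator (1 : Ω → ENNReal)) := Measurable.indicator measurable_const hG
    have mβ : Measurable[⨆ i ∈ (pastIndices j)ᶜ, noiseAlgebra x η β i]
        (fun ω => ENNReal.ofReal (β (j + 1 + l) ω ^ 2)) :=
      ((measurable_noise_beta (by simp [pastIndices]; omega)).pow_const 2).ennreal_ofReal
    have mI : Measurable[⨆ i ∈ (pastIndices j)ᶜ, noiseAlgebra x η β i]
        ((walkEvent ι₁ κ ρ β η j l).indicator
          (fun ω => ENNReal.ofReal ((c₁ * embNorm ι₂ (η (j + k) ω) + c₂) ^ 2))) :=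
      measurable_walkEvent_indicator hι₁ hι₂ (measurable_noise_eta (by simp [pastIndices]))
        (fun i _ => measurable_noise_eta (by simp [pastIndices]))
        (fun i _ => measurable_noise_beta (by simp [pastIndices]; omega))
    have mβI : Measurable[⨆ i ∈ (pastIndices j)ᶜ, noiseAlgebra x η β i]
        (fun ω => ENNReal.ofReal (β (j + 1 + l) ω ^ 2) * (walkEvent ι₁ κ ρ β η j l).indicator
          (fun ω => ENNReal.ofReal ((c₁ * embNorm ι₂ (η (j + k) ω) + c₂) ^ 2)) ω) := mβ.mul mI
    rw [e1, lintegral_mul_of_iIndep hle hind disjoint_compl_right mG mβI,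
      lintegral_indicator_one hG']
    refine mul_le_mul' le_rfl ?_
    have mβ' : Measurable[⨆ i ∈ ({Sum.inr (Sum.inr (j + 1 + l))} : Set (Unit ⊕ (ℕ ⊕ ℕ))),
        noiseAlgebra x η β i] (fun ω => ENNReal.ofReal (β (j + 1 + l) ω ^ 2)) :=
      ((measurable_noise_beta (Set.mem_singleton _)).pow_const 2).ennreal_ofReal
    have mI' : Measurable[⨆ i ∈ ({Sum.inr (Sum.inr (j + 1 + l))} : Set (Unit ⊕ (ℕ ⊕ ℕ)))ᶜ,
        noiseAlgebra x η β i] ((walkEvent ι₁ κ ρ β η j l).indicator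
          (fun ω => ENNReal.ofReal ((c₁ * embNorm ι₂ (η (j + k) ω) + c₂) ^ 2))) :=
      measurable_walkEvent_indicator hι₁ hι₂ (measurable_noise_eta (by simp))
        (fun i _ => measurable_noise_eta (by simp))
        (fun i hi => measurable_noise_beta (by simp; omega))
    rw [lintegral_mul_of_iIndep hle hind disjoint_compl_right mβ' mI', hβ2]
    exact mul_le_mul' le_rfl (htail j l (j + k))
  have mterm : ∀ l k, Measurable fun ω => (ENNReal.ofReal (β (j + 1 + l) ω ^ 2) *
      (walkEvent ι₁ κ ρ β η j l).indicator
        (fun ω => ENNReal.ofReal ((c₁ * embNorm ι₂ (η (j + k) ω) + c₂) ^ 2)) ω) := fun l k =>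
    ((hN.measurable_beta _).pow_const 2).ennreal_ofReal.mul
      (measurable_walkEvent_indicator hι₁ hι₂ (hN.measurable_eta _)
        (fun i _ => hN.measurable_eta _) (fun i _ => hN.measurable_beta _))
  unfold futureBound
  rw [lintegral_tsum fun l => ((Finset.measurable_fun_sum _ fun k _ =>
    mterm l k).const_mul _).aemeasurable, ← ENNReal.tsum_mul_left]
  refine ENNReal.tsum_le_tsum fun l => ?_
  rw [lintegral_const_mul _ (Finset.measurable_fun_sum _ fun k _ => mterm l k),
    lintegral_finsetSum _ fun k _ => mterm l k]
  refine (mul_le_mul' le_rfl (Finset.sum_le_sum fun k _ => hterm l k)).trans (le_of_eq ?_)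
  have hw := weight_pos l
  have hQ : (0 : ℝ) < l + 1 := by positivity
  rw [Finset.sum_const, Finset.card_range, nsmul_eq_mul, ← ENNReal.ofReal_mul hB0,
    ← ENNReal.ofReal_natCast]
  -- The factor l + 1 counts the inner summands; with the weight and the tail it collapses to the
  -- summable inverse weight.
  have e2 : B * C * (weight l)⁻¹ =
      (weight l * (l + 1)) * (((l + 1 : ℕ) : ℝ) * (B * (C * ((l + 1 : ℝ) ^ 5)⁻¹))) := by
    have h3 := weight_mul_self l
    have h5 : (l + 1 : ℝ) ^ 5 = (l + 1) ^ 2 * (weight l * weight l) := by rw [h3]; ring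
    rw [h5]
    push_cast
    field_simp
  rw [e2, ENNReal.ofReal_mul (p := weight l * (l + 1)) (by positivity),
    ENNReal.ofReal_mul (p := ((l + 1 : ℕ) : ℝ)) (by positivity)]
  ring

end Future

/-! ### Decomposition by the index of the starting extinction. -/

section Main

variable {V V₁ V₂ W Ω : Type*} [NormedAddCommGroup V] [NormedSpace ℝ V] [CompleteSpace V]
  [SecondCountableTopology V] [MeasurableSpace V] [BorelSpace V]
  [NormedAddCommGroup V₁] [NormedSpace ℝ V₁] [CompleteSpace V₁]
  [TopologicalSpace.SeparableSpace V₁] [NormedAddCommGroup V₂] [NormedSpace ℝ V₂]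
  [NormedAddCommGroup W] [NormedSpace ℝ W] [SecondCountableTopology W] [MeasurableSpace W]
  [BorelSpace W] {mΩ : MeasurableSpace Ω} {P : Measure Ω} [IsProbabilityMeasure P]
  {A : V → Set V} {ι₁ : V₁ →L[ℝ] V} {ι₂ : V₂ →L[ℝ] V} {κ ρ ε c₁ c₂ : ℝ}
  {β : ℕ → Ω → ℝ} {η : ℕ → Ω → V} {Ξ : V → W} {x : Ω → V}

lemma ae_between_extinctions (hA : Accretive A) (hD : DenselyDefined A)
    (hι₁ : Function.Injective ι₁) (hι₂ : Function.Injective ι₂)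
    (hT : SemigroupAssumption A ι₁ ι₂ κ ρ) (hN : NoiseAssumption P ι₁ ι₂ κ ρ ε β η)
    (hΞ : Measurable Ξ) (hc₁ : 0 ≤ c₁) (hc₂ : 0 ≤ c₂)
    (hΞb : ∀ v : V₂, ‖Ξ (ι₂ v)‖ ≤ c₁ * ‖v‖ + c₂)
    (hx : IndependentInitial P ι₁ ι₂ ρ β η x) (n : ℕ) :
    ∀ᵐ ω ∂P, ∃ j : ℕ, extinctionIndex A β η x (n + 1) ω = ((j + 1 : ℕ) : ℕ∞) ∧
      extinctionIndex A β η x (n + 2) ω < ⊤ ∧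
      IntervalIntegrable (fun t => Ξ (genProcess A β η x t ω)) volume
        (extinctionTime A β η x (n + 1) ω) (extinctionTime A β η x (n + 2) ω) ∧
      ‖∫ t in (extinctionTime A β η x (n + 1) ω)..(extinctionTime A β η x (n + 2) ω),
        Ξ (genProcess A β η x t ω)‖ₑ ^ 2 ≤ ENNReal.ofReal (∑' l, (weight l)⁻¹) *
          futureBound ι₁ ι₂ κ ρ c₁ c₂ β η j ω := by
  have hβ0 := hN.beta_pos
  have hmeas : ∀ ω, AEStronglyMeasurable (fun t => Ξ (genProcess A β η x t ω)) volume := fun ω =>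
    ((hΞ.comp (measurable_genProcess hA hD hβ0 hx.measurable hN.measurable_eta
      hN.measurable_beta)).comp (measurable_id.prodMk measurable_const)).aestronglyMeasurable
  filter_upwards [hx.mem₁, hx.mem₂, ae_all_iff.2 hN.eta_mem₁, ae_all_iff.2 hN.eta_mem₂,
    hN.tendsto_walk hι₁] with ω hx₁ hx₂ hη₁ hη₂ hwalk
  have hfin := hT.extinctionIndex_lt_top hι₁ hβ0 hx₁ hη₁ hwalk
  obtain ⟨M, hM⟩ := ENat.ne_top_iff_exists.1 (hfin (n + 1)).ne
  obtain ⟨j, rfl, -⟩ := exists_of_extinctionIndex_succ_eq hM.symm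
  obtain ⟨hint, L, hL, hE⟩ := hT.integral_between_extinctions hι₁ hι₂ hβ0 hx₁ hη₁ hx₂ hη₂ hc₁ hc₂
    hΞb (hmeas ω) hM.symm (hfin (n + 2))
  exact ⟨j, hM.symm, hfin _, hint, enorm_sq_le_futureBound hL hE⟩

variable [CompleteSpace V₂] [TopologicalSpace.SeparableSpace V₂]

/-- The events that the starting extinction has index j + 1 are disjoint, cover Ω up to a null set
and belong to the past of j. On each of them the square integral is at most a fixed constant times
its probability. -/
lemma memLp_integral_between_extinctions (hA : Accretive A) (hD : DenselyDefined A)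
    (hι₁ : Function.Injective ι₁) (hι₂ : Function.Injective ι₂)
    (hT : SemigroupAssumption A ι₁ ι₂ κ ρ) (hN : NoiseAssumption P ι₁ ι₂ κ ρ ε β η)
    (hΞ : Measurable Ξ) (hc₁ : 0 ≤ c₁) (hc₂ : 0 ≤ c₂)
    (hΞb : ∀ v : V₂, ‖Ξ (ι₂ v)‖ ≤ c₁ * ‖v‖ + c₂)
    (hx : IndependentInitial P ι₁ ι₂ ρ β η x) (n : ℕ) :
    MemLp (fun ω => ∫ τ in (extinctionTime A β η x (n + 1) ω)..
      (extinctionTime A β η x (n + 2) ω), Ξ (genProcess A β η x τ ω)) 2 P := by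
  have hβ0 := hN.beta_pos
  have hpath := ae_between_extinctions hA hD hι₁ hι₂ hT hN hΞ hc₁ hc₂ hΞb hx n
  refine ⟨(stronglyMeasurable_intervalIntegral_genProcess hA hD hβ0 hx.measurable
      hN.measurable_eta hN.measurable_beta hΞ _ _).aestronglyMeasurable, ?_⟩
  rw [eLpNorm_lt_top_iff_lintegral_rpow_enorm_lt_top two_ne_zero ENNReal.ofNat_ne_top]
  simp only [ENNReal.toReal_ofNat, ENNReal.rpow_ofNat]
  obtain ⟨C, hC, hbound⟩ := hN.exists_lintegral_futureBound_le hx hι₁ hι₂ hc₁ hc₂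
  set G : ℕ → Set Ω := fun j => {ω | extinctionIndex A β η x (n + 1) ω = ((j + 1 : ℕ) : ℕ∞)}
  have hG : ∀ j, MeasurableSet[⨆ i ∈ pastIndices j, noiseAlgebra x η β i] (G j) := fun j =>
    measurableSet_extinctionIndex_eq hA hD hβ0 (measurable_noise_init (by simp [pastIndices]))
      (n + 1) (j + 1) (fun i hi => measurable_noise_eta (by simp [pastIndices]; omega))
      (fun i hi => measurable_noise_beta (by simp [pastIndices]; omega))
  have hG' : ∀ j, MeasurableSet (G j) := fun j =>
    measurableSet_extinctionIndex_eq hA hD hβ0 hx.measurable (n + 1) (j + 1)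
      (fun i _ => hN.measurable_eta i) (fun i _ => hN.measurable_beta i)
  have hdisj : Pairwise (Function.onFun Disjoint G) := by
    intro i j hij
    refine Set.disjoint_left.2 fun ω hi hj => hij ?_
    have h : ((i + 1 : ℕ) : ℕ∞) = ((j + 1 : ℕ) : ℕ∞) := Eq.trans (Eq.symm hi) hj
    have := Nat.cast_injective h
    omega
  have hcover : P (⋃ j, G j)ᶜ = 0 := by
    rw [← mem_ae_iff]
    filter_upwards [hpath] with ω ⟨j, hj, _⟩
    exact Set.mem_iUnion.2 ⟨j, hj⟩
  set K := ENNReal.ofReal (∑' l, (weight l)⁻¹)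
  have hsum : ∑' j, P (G j) ≤ 1 := by
    rw [← measure_iUnion hdisj hG']
    exact prob_le_one
  have hpiece : ∀ j, ∫⁻ ω in G j, ‖∫ t in (extinctionTime A β η x (n + 1) ω)..
      (extinctionTime A β η x (n + 2) ω), Ξ (genProcess A β η x t ω)‖ₑ ^ 2 ∂P ≤
      K * (P (G j) * C) := by
    intro j
    refine (lintegral_mono_ae (g := fun ω => K * futureBound ι₁ ι₂ κ ρ c₁ c₂ β η j ω) ?_).trans ?_
    · rw [ae_restrict_iff' (hG' j)]
      filter_upwards [hpath] with ω ⟨i, hi, _, _, hb⟩ hω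
      have h : ((i + 1 : ℕ) : ℕ∞) = ((j + 1 : ℕ) : ℕ∞) := hi.symm.trans hω
      obtain rfl : i = j := by
        have := Nat.cast_injective h
        omega
      exact hb
    · rw [lintegral_const_mul' _ _ ENNReal.ofReal_ne_top]
      exact mul_le_mul' le_rfl (hbound j (G j) (hG j))
  calc _ = ∫⁻ ω in ⋃ j, G j, ‖∫ t in (extinctionTime A β η x (n + 1) ω)..
      (extinctionTime A β η x (n + 2) ω), Ξ (genProcess A β η x t ω)‖ₑ ^ 2 ∂P := by
        rw [← lintegral_add_compl _ (MeasurableSet.iUnion hG'),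
          Measure.restrict_zero_set hcover, lintegral_zero_measure, add_zero]
    _ ≤ ∑' j, K * (P (G j) * C) := by
        rw [lintegral_iUnion hG' hdisj]
        exact ENNReal.tsum_le_tsum hpiece
    _ = K * ((∑' j, P (G j)) * C) := by rw [ENNReal.tsum_mul_left, ENNReal.tsum_mul_right]
    _ ≤ K * (1 * C) := mul_le_mul' le_rfl (mul_le_mul' hsum le_rfl)
    _ < ⊤ := by
        rw [one_mul]
        exact ENNReal.mul_lt_top ENNReal.ofReal_lt_top hC.lt_top

end Main

end

end RandomCauchy

theorem lemma3p10
    {V V₁ V₂ W Ω : Type*}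
    [NormedAddCommGroup V] [NormedSpace ℝ V] [CompleteSpace V]
    [TopologicalSpace.SeparableSpace V] [MeasurableSpace V] [BorelSpace V]
    [NormedAddCommGroup V₁] [NormedSpace ℝ V₁] [CompleteSpace V₁]
    [TopologicalSpace.SeparableSpace V₁]
    [NormedAddCommGroup V₂] [NormedSpace ℝ V₂] [CompleteSpace V₂]
    [TopologicalSpace.SeparableSpace V₂]
    [NormedAddCommGroup W] [NormedSpace ℝ W] [CompleteSpace W]
    [TopologicalSpace.SeparableSpace W] [MeasurableSpace W] [BorelSpace W]
    [MeasurableSpace Ω] (P : Measure Ω) [IsProbabilityMeasure P]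
    (A : V → Set V) (hA : RandomCauchy.MAccretive A) (hD : RandomCauchy.DenselyDefined A)
    (ι₁ : V₁ →L[ℝ] V) (hι₁ : Function.Injective ι₁)
    (ι₂ : V₂ →L[ℝ] V) (hι₂ : Function.Injective ι₂)
    (κ ρ ε : ℝ) (hT : RandomCauchy.SemigroupAssumption A ι₁ ι₂ κ ρ)
    (β : ℕ → Ω → ℝ) (η : ℕ → Ω → V)
    (hN : RandomCauchy.NoiseAssumption P ι₁ ι₂ κ ρ ε β η)
    (Ξ : V → W) (hΞ : RandomCauchy.SubLinear ι₂ Ξ)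
    (x : Ω → V) (hx : RandomCauchy.IndependentInitial P ι₁ ι₂ ρ β η x)
    (n : ℕ) (hn : 1 ≤ n) :
    (∀ᵐ ω ∂P,
      RandomCauchy.extinctionIndex A β η x n ω < ⊤ ∧
      RandomCauchy.extinctionIndex A β η x (n + 1) ω < ⊤ ∧
      IntervalIntegrable (fun τ => Ξ (RandomCauchy.genProcess A β η x τ ω)) volume
        (RandomCauchy.extinctionTime A β η x n ω)
        (RandomCauchy.extinctionTime A β η x (n + 1) ω)) ∧
    MemLp (fun ω => ∫ τ in (RandomCauchy.extinctionTime A β η x n ω)..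
        (RandomCauchy.extinctionTime A β η x (n + 1) ω),
        Ξ (RandomCauchy.genProcess A β η x τ ω)) 2 P := by
  have : SecondCountableTopology V := UniformSpace.secondCountable_of_separable V
  have : SecondCountableTopology W := UniformSpace.secondCountable_of_separable W
  -- With n ≥ 1 the interval starts at a genuine extinction, so x does not enter the bound on the
  -- integral.
  obtain ⟨n, rfl⟩ := Nat.exists_eq_add_of_le' hn
  obtain ⟨c₁, c₂, hc₁, hc₂, hΞb⟩ := hΞ.bound
  refine ⟨?_, RandomCauchy.memLp_integral_between_extinctions hA.1 hD hι₁ hι₂ hT hN hΞ.measurable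
    hc₁ hc₂ hΞb hx n⟩
  filter_upwards [RandomCauchy.ae_between_extinctions hA.1 hD hι₁ hι₂ hT hN hΞ.measurable
    hc₁ hc₂ hΞb hx n] with ω ⟨j, hj, hfin, hint, _⟩
  exact ⟨hj ▸ ENat.natCast_lt_top _, hfin, hint⟩
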